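/- Let $M$ be a smooth (Hausdorff, second countable) manifold of real dimension $4n$, $n\ge 0$, with a hypercomplex structure $(I,J,K)$, that is, smooth integrable almost complex structures $I,J,K$ on $M$ with $IJ=-JI=K$; so $\dim_{\mathbb H}M=n$. Let $c_1(M,I)\in H^2(M,\mathbb Z)$ be the first Chern class of the complex manifold $(M,I)$, that is, of the complex vector bundle $(TM,I)$. Then $c_1(M,I)=0$. -/

import Mathlib

open CategoryTheory TopologicalSpace Opposite Bundle
open scoped Manifold ContDiff Topology

universe u

namespace Hypercomplex

noncomputable section

/-! ### Sheaves of abelian groups given by local conditions -/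

/-- The category of sheaves of abelian groups on a topological space. -/
abbrev AbSheaf (X : TopCat.{u}) := Sheaf (Opens.grothendieckTopology X) AddCommGrpCat.{u}

/-- A local condition on sections of a family `G` of abelian groups, stable under the group
operations. -/
structure LocalAddPredicate {X : TopCat.{u}} (G : X → Type) [∀ x, AddCommGroup (G x)]
    extends TopCat.LocalPredicate G where
  zero_mem : ∀ {U : Opens X}, pred (fun x : U ↦ (0 : G x))
  add_mem : ∀ {U : Opens X} {f g : ∀ x : U, G x}, pred f → pred g → pred (fun x ↦ f x + g x)
  neg_mem : ∀ {U : Opens X} {f : ∀ x : U, G x}, pred f → pred (fun x ↦ - f x)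

namespace LocalAddPredicate

variable {X : TopCat.{u}} {G G' : X → Type} [∀ x, AddCommGroup (G x)] [∀ x, AddCommGroup (G' x)]

/-- The sections over `U` satisfying the local condition. -/
def sections (P : LocalAddPredicate G) (U : Opens X) : AddSubgroup (∀ x : U, G x) where
  carrier := {f | P.pred f}
  zero_mem' := P.zero_mem
  add_mem' := P.add_mem
  neg_mem' := P.neg_mem

/-- The presheaf of sections satisfying the local condition. -/
def presheaf (P : LocalAddPredicate G) : (Opens X)ᵒᵖ ⥤ AddCommGrpCat.{u} where
  obj U := AddCommGrpCat.of (P.sections U.unop)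
  map i := AddCommGrpCat.ofHom
    { toFun := fun f ↦ ⟨fun x ↦ f.1 (i.unop x), P.res i.unop f.1 f.2⟩
      map_zero' := rfl
      map_add' := fun _ _ ↦ rfl }

/-- The sheaf of sections satisfying the local condition. -/
def sheaf (P : LocalAddPredicate G) : AbSheaf X where
  obj := P.presheaf
  property := (TopCat.Presheaf.isSheaf_iff_isSheaf_comp (forget AddCommGrpCat.{u}) P.presheaf).2
    (TopCat.subpresheafToTypes.isSheaf P.toLocalPredicate)

/-- The morphism of sheaves induced by fibrewise homomorphisms respecting the conditions. -/
def hom (P : LocalAddPredicate G) (Q : LocalAddPredicate G') (φ : ∀ x, G x →+ G' x)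
    (h : ∀ {U : Opens X} (f : ∀ x : U, G x), P.pred f → Q.pred (fun x : U ↦ φ x (f x))) :
    P.sheaf ⟶ Q.sheaf where
  hom :=
    { app := fun U ↦ AddCommGrpCat.ofHom
        { toFun := fun f ↦ ⟨fun x ↦ φ x (f.1 x), h f.1 f.2⟩
          map_zero' := Subtype.ext (funext fun x ↦ map_zero (φ x))
          map_add' := fun _ _ ↦ Subtype.ext (funext fun x ↦ map_add (φ x) _ _) } }

end LocalAddPredicate

theorem shortExact_of_sections {X : TopCat.{u}} (S : ShortComplex (AbSheaf X))
    (hf : ∀ U, Function.Injective (S.f.hom.app U))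
    (hex : ∀ U s, S.g.hom.app U s = 0 → ∀ x ∈ U.unop, ∃ (V : Opens X) (i : V ⟶ U.unop), x ∈ V ∧
      ∃ t, S.f.hom.app (op V) t = S.X₂.obj.map i.op s)
    (hg : ∀ (U : Opens X) (s : S.X₃.obj.obj (op U)), ∀ x ∈ U, ∃ (V : Opens X) (i : V ⟶ U), x ∈ V ∧
      ∃ t, S.g.hom.app (op V) t = S.X₃.obj.map i.op s) : S.ShortExact := by
  have : Mono S.f := Sheaf.mono_of_injective _ hf
  have : Epi S.g := by
    rw [← Sheaf.isLocallySurjective_iff_epi']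
    refine ⟨fun {U} s x hx ↦ ?_⟩
    obtain ⟨V, i, hV, t, ht⟩ := hg U s x hx
    exact ⟨V, i, ⟨t, ht⟩, hV⟩
  refine ⟨?_⟩
  refine (TopCat.Sheaf.exact_iff_stalkFunctor_map_exact (X := X) (C := AddCommGrpCat.{u}) S).2
    fun x ↦ ?_
  rw [ShortComplex.ab_exact_iff]
  intro s hs
  obtain ⟨U, hxU, s, rfl⟩ := TopCat.Presheaf.exists_germ_eq (F := S.X₂.obj) (x := x) s
  have hs' : TopCat.Presheaf.germ S.X₃.obj U x hxU (S.g.hom.app (op U) s) =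
      TopCat.Presheaf.germ S.X₃.obj U x hxU 0 := by
    rw [map_zero]
    refine Eq.trans ?_ hs
    exact (TopCat.Presheaf.stalkFunctor_map_germ_apply U x hxU S.g.hom s).symm
  obtain ⟨W, hxW, i, j, h⟩ := TopCat.Presheaf.germ_eq (F := S.X₃.obj) x hxU hxU _ _ hs'
  rw [map_zero] at h
  obtain ⟨V, k, hxV, t, ht⟩ := hex (op W) (S.X₂.obj.map i.op s) (by
    rw [← h]; exact NatTrans.naturality_apply S.g.hom i.op s) x hxW
  refine ⟨TopCat.Presheaf.germ S.X₁.obj V x hxV t, ?_⟩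
  refine (TopCat.Presheaf.stalkFunctor_map_germ_apply V x hxV S.f.hom t).trans ?_
  rw [ht]
  refine (TopCat.Presheaf.germ_res_apply S.X₂.obj k x hxV _).trans ?_
  exact TopCat.Presheaf.germ_res_apply S.X₂.obj i x hxW s

/-- Continuity, as a local condition on functions with values in a topological abelian group. -/
def continuousAddPredicate (X : TopCat.{u}) (A : Type) [AddCommGroup A] [TopologicalSpace A]
    [IsTopologicalAddGroup A] : LocalAddPredicate (fun _ : X ↦ A) where
  toLocalPredicate := TopCat.continuousLocal X A
  zero_mem := continuous_const
  add_mem h h' := Continuous.add h h'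
  neg_mem h := Continuous.neg h

/-- The sheaf of continuous functions with values in a topological abelian group `A`. If `A` is
discrete this is the sheaf of locally constant functions, i.e. the constant sheaf `A`. -/
abbrev continuousSheaf (X : TopCat.{u}) (A : Type) [AddCommGroup A] [TopologicalSpace A]
    [IsTopologicalAddGroup A] : AbSheaf X := (continuousAddPredicate X A).sheaf

/-! ### Integral cohomology and the exponential sequence -/

/-- The integral cohomology `Hᵏ(X, ℤ)`: sheaf cohomology of the sheaf of locally constant
integer-valued functions. -/
abbrev IntegralCohomology (X : TopCat.{u}) (k : ℕ) := Sheaf.H (continuousSheaf X ℤ) k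

/-- The inclusion of `ℤ` in `ℂ`. -/
def intToComplex : ℤ →+ ℂ := Int.castAddHom ℂ

/-- The homomorphism `z ↦ exp (2 π i z)` from `ℂ` to `ℂˣ`. -/
def expHom : ℂ →+ Additive ℂˣ where
  toFun z := Additive.ofMul
    (Units.mk0 (Complex.exp (2 * Real.pi * Complex.I * z)) (Complex.exp_ne_zero _))
  map_zero' := by
    apply Additive.toMul.injective
    ext
    simp
  map_add' z w := by
    apply Additive.toMul.injective
    ext
    simp [mul_add, Complex.exp_add]

theorem expHom_val (z : ℂ) :
    ((Additive.toMul (expHom z) : ℂˣ) : ℂ) = Complex.exp (2 * Real.pi * Complex.I * z) := rfl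

theorem continuous_iff_val {Y : Type*} [TopologicalSpace Y] {f : Y → Additive ℂˣ} :
    Continuous f ↔ Continuous fun y ↦ ((Additive.toMul (f y) : ℂˣ) : ℂ) :=
  Units.isEmbedding_val₀.continuous_iff

theorem continuous_expHom : Continuous expHom := by
  rw [continuous_iff_val]
  simp only [expHom_val]
  fun_prop

theorem expHom_eq_zero_iff (z : ℂ) : expHom z = 0 ↔ ∃ k : ℤ, (k : ℂ) = z := by
  have h : expHom z = 0 ↔ Complex.exp (2 * Real.pi * Complex.I * z) = 1 := by
    rw [← expHom_val]
    constructor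
    · intro h; rw [h]; rfl
    · intro h; apply Additive.toMul.injective; ext; exact h
  have hpi : (2 * Real.pi * Complex.I : ℂ) ≠ 0 := Complex.two_pi_I_ne_zero
  rw [h, Complex.exp_eq_one_iff]
  refine exists_congr fun k ↦ ?_
  rw [mul_comm, mul_left_inj' hpi, eq_comm]

/-- The exponential sequence `0 → ℤ → C⁰(ℂ) → C⁰(ℂˣ) → 0` of sheaves on `X`. -/
def exponentialSequence (X : TopCat.{u}) : ShortComplex (AbSheaf X) where
  X₁ := continuousSheaf X ℤ
  X₂ := continuousSheaf X ℂ
  X₃ := continuousSheaf X (Additive ℂˣ)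
  f := LocalAddPredicate.hom _ _ (fun _ ↦ intToComplex)
    (fun _ hf ↦ continuous_of_discreteTopology.comp hf)
  g := LocalAddPredicate.hom _ _ (fun _ ↦ expHom) (fun _ hf ↦ continuous_expHom.comp hf)
  zero := by
    ext U f
    exact Subtype.ext (funext fun x ↦ (expHom_eq_zero_iff _).2 ⟨_, rfl⟩)

theorem exponentialSequence_shortExact (X : TopCat.{u}) : (exponentialSequence X).ShortExact := by
  apply shortExact_of_sections
  · intro U f g h
    refine Subtype.ext (funext fun x ↦ Int.cast_injective (α := ℂ) ?_)
    exact congrFun (congrArg Subtype.val h) x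
  · intro U s hs x hx
    have hs' : ∀ y, expHom (s.1 y) = 0 := fun y ↦ congrFun (congrArg Subtype.val hs) y
    choose k hk using fun y ↦ (expHom_eq_zero_iff _).1 (hs' y)
    refine ⟨U.unop, 𝟙 _, hx, ⟨k, ?_⟩, Subtype.ext (funext fun y ↦ hk y)⟩
    have hre : Continuous fun y ↦ (k y : ℝ) := by
      have : (fun y ↦ (k y : ℝ)) = fun y ↦ (s.1 y).re := funext fun y ↦ by simp [← hk y]
      rw [this]
      exact Complex.continuous_re.comp s.2
    exact Int.isClosedEmbedding_coe_real.isEmbedding.continuous_iff.2 hre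
  · intro U s x hx
    let c : U → ℂ := fun y ↦ ((Additive.toMul (s.1 y) : ℂˣ) : ℂ)
    have hc : Continuous c := continuous_iff_val.1 s.2
    have hc0 : ∀ y, c y ≠ 0 := fun y ↦ Units.ne_zero _
    let q : U → ℂ := fun y ↦ c y / c ⟨x, hx⟩
    have hq : Continuous q := hc.div_const _
    have hq1 : q ⟨x, hx⟩ = 1 := div_self (hc0 _)
    have hO : IsOpen (q ⁻¹' Complex.slitPlane) := Complex.isOpen_slitPlane.preimage hq
    let V : Opens X := ⟨Subtype.val '' (q ⁻¹' Complex.slitPlane),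
      U.isOpen.isOpenMap_subtype_val _ hO⟩
    have hVU : V ≤ U := by rintro _ ⟨y, _, rfl⟩; exact y.2
    have hpi : (2 * Real.pi * Complex.I : ℂ) ≠ 0 := Complex.two_pi_I_ne_zero
    let l : V → ℂ := fun y ↦ (Complex.log (q ⟨y, hVU y.2⟩) + Complex.log (c ⟨x, hx⟩)) /
      (2 * Real.pi * Complex.I)
    have hl : Continuous l := by
      refine Continuous.div_const (Continuous.add ?_ continuous_const) _
      refine Continuous.clog (hq.comp (by fun_prop)) ?_
      rintro ⟨_, y, hy, rfl⟩
      exact hy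
    refine ⟨V, homOfLE hVU, ⟨⟨x, hx⟩, by simp [hq1], rfl⟩, ⟨l, hl⟩, ?_⟩
    refine Subtype.ext (funext fun y ↦ Additive.toMul.injective (Units.ext ?_))
    change Complex.exp (2 * Real.pi * Complex.I * l y) = c ⟨y, hVU y.2⟩
    have : q ⟨y, hVU y.2⟩ ≠ 0 := div_ne_zero (hc0 _) (hc0 _)
    rw [mul_div_cancel₀ _ hpi, Complex.exp_add, Complex.exp_log this, Complex.exp_log (hc0 _)]
    exact div_mul_cancel₀ _ (hc0 _)

/-- The connecting homomorphism in sheaf cohomology of a short exact sequence. -/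
def connectingHom {X : TopCat.{u}} {S : ShortComplex (AbSheaf X)} (hS : S.ShortExact) (k : ℕ) :
    Sheaf.H S.X₃ k →+ Sheaf.H S.X₁ (k + 1) :=
  hS.extClass.postcomp _ rfl

/-- The class in `H⁰(X, ℤ)` of the constant function `1`. -/
def integralUnit (X : TopCat.{u}) : IntegralCohomology X 0 :=
  (Sheaf.H.equiv₀ (continuousSheaf X ℤ) Limits.isTerminalTop).symm ⟨fun _ ↦ 1, continuous_const⟩

/-! ### Complex frames and the determinant line bundle of a complex vector bundle

A complex vector bundle is given as a real vector bundle `V` (with model fibre `F`) together with a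
continuous field `J` of endomorphisms with `J² = -1`. -/

section Linear

variable {m : ℕ}

/-- The matrix of a complex-linear map `ℂᵐ → ℂᵐ`, seen as a real-linear map. -/
def complexMatrix (T : (Fin m → ℂ) →L[ℝ] (Fin m → ℂ)) : Matrix (Fin m) (Fin m) ℂ :=
  Matrix.of fun i j ↦ T (Pi.single j 1) i

theorem complexMatrix_mulVec (T : (Fin m → ℂ) →L[ℝ] (Fin m → ℂ))
    (hT : ∀ z, T (Complex.I • z) = Complex.I • T z) (z : Fin m → ℂ) :
    (complexMatrix T).mulVec z = T z := by
  have hsmul : ∀ (c : ℂ) (w : Fin m → ℂ), T (c • w) = c • T w := by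
    intro c w
    have hc : ∀ w' : Fin m → ℂ, c • w' = c.re • w' + c.im • (Complex.I • w') := by
      intro w'
      ext i
      simp only [Pi.smul_apply, Pi.add_apply, smul_eq_mul, Complex.real_smul]
      conv_lhs => rw [← Complex.re_add_im c]
      ring
    rw [hc w, map_add, map_smul, map_smul, hT, ← hc]
  let T' : (Fin m → ℂ) →ₗ[ℂ] (Fin m → ℂ) :=
    { toFun := T, map_add' := map_add T, map_smul' := hsmul }
  have : complexMatrix T = LinearMap.toMatrix' T' := by
    ext i j
    simp [complexMatrix, T', LinearMap.toMatrix'_apply]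
  rw [this, LinearMap.toMatrix'_mulVec]
  rfl

theorem complexMatrix_comp (T T' : (Fin m → ℂ) →L[ℝ] (Fin m → ℂ))
    (hT : ∀ z, T (Complex.I • z) = Complex.I • T z) (A : Matrix (Fin m) (Fin m) ℂ)
    (h : ∀ z, T' z = T (A.mulVec z)) : complexMatrix T' = complexMatrix T * A := by
  ext i j
  have : complexMatrix T' i j = T' (Pi.single j 1) i := rfl
  rw [this, h, ← complexMatrix_mulVec T hT, Matrix.mulVec_mulVec, Matrix.mulVec_single_one]
  rfl

theorem det_complexMatrix_ne_zero (T : (Fin m → ℂ) →L[ℝ] (Fin m → ℂ))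
    (hT : ∀ z, T (Complex.I • z) = Complex.I • T z) (hinj : Function.Injective T) :
    (complexMatrix T).det ≠ 0 := by
  intro h
  obtain ⟨v, hv, hv'⟩ := Matrix.exists_mulVec_eq_zero_iff.2 h
  rw [complexMatrix_mulVec T hT] at hv'
  exact hv (hinj (by rw [hv', map_zero]))

theorem continuous_complexMatrix : Continuous (complexMatrix (m := m)) := by
  refine continuous_pi fun i ↦ continuous_pi fun j ↦ ?_
  change Continuous fun T : (Fin m → ℂ) →L[ℝ] (Fin m → ℂ) ↦ T (Pi.single j 1) i
  fun_prop

theorem exists_linear_frame {F : Type*} [NormedAddCommGroup F] [NormedSpace ℝ F]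
    [FiniteDimensional ℝ F] (J : F →L[ℝ] F) (hJ : ∀ v, J (J v) = -v) :
    ∃ u : (Fin (Module.finrank ℝ F / 2) → ℂ) ≃L[ℝ] F, ∀ z, u (Complex.I • z) = J (u z) := by
  have hJ' : (J : F →ₗ[ℝ] F) * (J : F →ₗ[ℝ] F) = -1 := by ext v; exact hJ v
  let ρ : ℂ →ₐ[ℝ] (F →ₗ[ℝ] F) := Complex.liftAux (J : F →ₗ[ℝ] F) hJ'
  let _ : Module ℂ F := Module.compHom F ρ.toRingHom
  have hI : ∀ v : F, Complex.I • v = J v := fun v ↦ by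
    change ρ Complex.I v = J v
    rw [Complex.liftAux_apply_I]; rfl
  have : IsScalarTower ℝ ℂ F := ⟨fun r c v ↦ by
    change ρ (r • c) v = r • ρ c v
    rw [map_smul]; rfl⟩
  have : FiniteDimensional ℂ F := FiniteDimensional.right ℝ ℂ F
  have hfin : Module.finrank ℂ F = Module.finrank ℝ F / 2 := by
    have h := Module.finrank_mul_finrank ℝ ℂ F
    rw [Complex.finrank_real_complex] at h
    omega
  let b := Module.finBasisOfFinrankEq ℂ F hfin
  let u := (b.equivFun.symm.restrictScalars ℝ).toContinuousLinearEquiv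
  refine ⟨u, fun z ↦ ?_⟩
  rw [← hI]
  exact map_smul b.equivFun.symm Complex.I z

end Linear

section Frames

variable {B : Type u} [TopologicalSpace B] (F : Type) [NormedAddCommGroup F] [NormedSpace ℝ F]
  (V : B → Type) [∀ x, AddCommGroup (V x)] [∀ x, Module ℝ (V x)] [∀ x, TopologicalSpace (V x)]
  [∀ x, IsTopologicalAddGroup (V x)] [∀ x, ContinuousSMul ℝ (V x)]
  [TopologicalSpace (TotalSpace F V)] [FiberBundle F V] [VectorBundle ℝ F V]

/-- A complex structure on a real vector bundle. -/
structure ComplexStructure where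
  J : ∀ x, V x →L[ℝ] V x
  continuous_J : Continuous fun x ↦ TotalSpace.mk' (F →L[ℝ] F) (E := fun x ↦ V x →L[ℝ] V x) x (J x)
  J_J : ∀ x v, J x (J x v) = -v

variable {F V}

/-- The complex rank of a complex vector bundle. -/
abbrev ComplexStructure.rank (_ : ComplexStructure F V) : ℕ := Module.finrank ℝ F / 2

/-- The real vector bundle `Hom_ℝ(ℂᵐ, V)`. -/
abbrev ComplexStructure.HomBundle (C : ComplexStructure F V) :=
  TotalSpace ((Fin C.rank → ℂ) →L[ℝ] F)
    (fun x ↦ Bundle.Trivial B (Fin C.rank → ℂ) x →L[ℝ] V x)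

/-- A (complex) frame of the fibre at `x`: a complex-linear isomorphism `ℂᵐ ≃ (V x, J)`. -/
def ComplexStructure.IsFrame (C : ComplexStructure F V) (x : B)
    (u : Bundle.Trivial B (Fin C.rank → ℂ) x →L[ℝ] V x) : Prop :=
  Function.Bijective u ∧ ∀ z : Fin C.rank → ℂ, u (Complex.I • z : Fin C.rank → ℂ) = C.J x (u z)

/-- The frames of the fibre at `x`. -/
abbrev ComplexStructure.Frame (C : ComplexStructure F V) (x : B) :=
  {u : Bundle.Trivial B (Fin C.rank → ℂ) x →L[ℝ] V x // C.IsFrame x u}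

/-- The frame bundle restricted to `U`, as a subspace of `Hom_ℝ(ℂᵐ, V)`. -/
abbrev ComplexStructure.FrameBundle (C : ComplexStructure F V) (U : Set B) :=
  {p : C.HomBundle // p.1 ∈ U ∧ C.IsFrame p.1 p.2}

theorem ComplexStructure.exists_localFrame [FiniteDimensional ℝ F] (C : ComplexStructure F V) (x : B) :
    ∃ (N : Opens B) (_ : x ∈ N) (e : ∀ y : N, C.Frame y.1) (δ : ∀ y : N, C.Frame y.1 → ℂˣ),
      Continuous (fun y : N ↦ (⟨y.1, (e y).1⟩ : C.HomBundle)) ∧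
      Continuous (fun p : C.FrameBundle N ↦ δ ⟨p.1.1, p.2.1⟩ ⟨p.1.2, p.2.2⟩) ∧
      ∀ (y : N) (u v : C.Frame y.1) (A : GL (Fin C.rank) ℂ),
        (∀ z : Fin C.rank → ℂ, v.1 z = u.1 (A.1.mulVec z)) →
          δ y v = δ y u * Matrix.GeneralLinearGroup.det A := by
  let φ := trivializationAt F V x
  let T := trivializationAt ((Fin C.rank → ℂ) →L[ℝ] F)
    (fun x ↦ Bundle.Trivial B (Fin C.rank → ℂ) x →L[ℝ] V x) x
  have hxφ : x ∈ φ.baseSet := mem_baseSet_trivializationAt F V x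
  let Jφ : B → F →L[ℝ] F := fun y ↦ (φ.continuousLinearMapAt ℝ y).comp
    ((C.J y).comp (φ.symmL ℝ y))
  have hJcont : ContinuousOn Jφ φ.baseSet := by
    have h := (trivializationAt (F →L[ℝ] F) (fun x ↦ V x →L[ℝ] V x) x).continuousOn.comp
      C.continuous_J.continuousOn (s := φ.baseSet) (fun y hy ↦ ⟨hy, hy⟩)
    exact continuous_snd.comp_continuousOn h
  have hJφ : ∀ y ∈ φ.baseSet, ∀ v, Jφ y (φ.continuousLinearMapAt ℝ y v) =
      φ.continuousLinearMapAt ℝ y (C.J y v) := by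
    intro y hy v
    simp only [Jφ, ContinuousLinearMap.comp_apply]
    rw [φ.symmL_continuousLinearMapAt hy]
  have hJs : ∀ y ∈ φ.baseSet, ∀ v, φ.symmL ℝ y (Jφ y v) = C.J y (φ.symmL ℝ y v) := by
    intro y hy v
    simp only [Jφ, ContinuousLinearMap.comp_apply]
    rw [φ.symmL_continuousLinearMapAt hy]
  have hJJ : ∀ y ∈ φ.baseSet, ∀ v, Jφ y (Jφ y v) = -v := by
    intro y hy v
    have h1 : Jφ y v = φ.continuousLinearMapAt ℝ y (C.J y (φ.symmL ℝ y v)) := rfl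
    rw [h1, hJφ y hy, C.J_J, map_neg, φ.continuousLinearMapAt_symmL hy]
  obtain ⟨u₀, hu₀⟩ := exists_linear_frame (Jφ x) (hJJ x hxφ)
  let i₀ : (Fin C.rank → ℂ) →L[ℝ] (Fin C.rank → ℂ) :=
    (Complex.I • ContinuousLinearMap.id ℂ (Fin C.rank → ℂ)).restrictScalars ℝ
  have hi₀ : ∀ z, i₀ z = Complex.I • z := fun z ↦ rfl
  let E : B → (Fin C.rank → ℂ) →L[ℝ] F := fun y ↦
    (2⁻¹ : ℝ) • ((u₀ : (Fin C.rank → ℂ) →L[ℝ] F) -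
      (Jφ y).comp ((u₀ : (Fin C.rank → ℂ) →L[ℝ] F).comp i₀))
  have hEapp : ∀ y z, E y z = (2⁻¹ : ℝ) • (u₀ z - Jφ y (u₀ (Complex.I • z))) := fun y z ↦ rfl
  have hEx : E x = u₀ := by
    ext1 z
    rw [hEapp, hu₀, hJJ x hxφ, sub_neg_eq_add, ← two_smul ℝ, smul_smul]
    norm_num
  have hEI : ∀ y ∈ φ.baseSet, ∀ z, E y (Complex.I • z) = Jφ y (E y z) := by
    intro y hy z
    rw [hEapp, hEapp, (Jφ y).map_smul, map_sub, hJJ y hy, smul_smul, Complex.I_mul_I,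
      neg_one_smul, map_neg, map_neg]
    congr 1
    abel
  have hEcont : ContinuousOn E φ.baseSet := by
    have h : ContinuousOn (fun y ↦ (u₀ : (Fin C.rank → ℂ) →L[ℝ] F) -
        (Jφ y).comp ((u₀ : (Fin C.rank → ℂ) →L[ℝ] F).comp i₀)) φ.baseSet := by
      refine continuousOn_const.sub ?_
      exact hJcont.clm_comp continuousOn_const
    exact h.const_smul (2⁻¹ : ℝ)
  let S : Set ((Fin C.rank → ℂ) →L[ℝ] F) :=
    Set.range ((↑) : ((Fin C.rank → ℂ) ≃L[ℝ] F) → ((Fin C.rank → ℂ) →L[ℝ] F))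
  have hS : IsOpen S := ContinuousLinearEquiv.isOpen
  let N : Opens B := ⟨φ.baseSet ∩ E ⁻¹' S, hEcont.isOpen_inter_preimage φ.open_baseSet hS⟩
  have hNφ : ∀ y : N, y.1 ∈ φ.baseSet := fun y ↦ y.2.1
  choose ε hε using fun y : N ↦ y.2.2
  have hεI : ∀ (y : N) z, ε y (Complex.I • z) = Jφ y (ε y z) := by
    intro y z
    have := hEI y (hNφ y) z
    rw [← hε y] at this
    exact this
  have hεcont : Continuous fun y : N ↦ (ε y : (Fin C.rank → ℂ) →L[ℝ] F) := by
    simp only [hε]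
    exact hEcont.comp_continuous continuous_subtype_val hNφ
  have hεsymm : Continuous fun y : N ↦ ((ε y).symm : F →L[ℝ] (Fin C.rank → ℂ)) := by
    rw [continuous_iff_continuousAt]
    intro y
    have h1 := (contDiffAt_map_inverse (𝕜 := ℝ) (n := 0) (ε y)).continuousAt
    have h2 : ContinuousAt (fun y : N ↦ ContinuousLinearMap.inverse
      (ε y : (Fin C.rank → ℂ) →L[ℝ] F)) y :=
      ContinuousAt.comp (f := fun y : N ↦ (ε y : (Fin C.rank → ℂ) →L[ℝ] F)) h1
        hεcont.continuousAt
    simpa only [ContinuousLinearMap.inverse_equiv] using h2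
  -- the frame
  have he : ∀ y : N, C.IsFrame y.1 ((φ.symmL ℝ y.1).comp (ε y : (Fin C.rank → ℂ) →L[ℝ] F)) := by
    intro y
    refine ⟨?_, fun z ↦ ?_⟩
    · have hb : Function.Bijective (φ.symmL ℝ y.1) :=
        Function.bijective_iff_has_inverse.2 ⟨φ.continuousLinearMapAt ℝ y.1,
          φ.continuousLinearMapAt_symmL (hNφ y), φ.symmL_continuousLinearMapAt (hNφ y)⟩
      exact hb.comp (ε y).bijective
    · change φ.symmL ℝ y.1 (ε y (Complex.I • z)) = C.J y.1 (φ.symmL ℝ y.1 (ε y z))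
      rw [hεI, hJs y.1 (hNφ y)]
  -- the coordinates of a frame
  let κ : ∀ y : N, C.Frame y.1 → (Fin C.rank → ℂ) →L[ℝ] (Fin C.rank → ℂ) := fun y u ↦
    ((ε y).symm : F →L[ℝ] (Fin C.rank → ℂ)).comp ((φ.continuousLinearMapAt ℝ y.1).comp u.1)
  have hκapp : ∀ y u z, κ y u z = (ε y).symm (φ.continuousLinearMapAt ℝ y.1 (u.1 z)) :=
    fun y u z ↦ rfl
  have hκI : ∀ y u z, κ y u (Complex.I • z) = Complex.I • κ y u z := by
    intro y u z
    apply (ε y).injective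
    rw [hεI, hκapp, hκapp, (ε y).apply_symm_apply, (ε y).apply_symm_apply, hJφ y.1 (hNφ y)]
    exact congrArg _ (u.2.2 z)
  have hκinj : ∀ y u, Function.Injective (κ y u) := by
    intro y u
    have hb : Function.Bijective (φ.continuousLinearMapAt ℝ y.1) :=
      Function.bijective_iff_has_inverse.2 ⟨φ.symmL ℝ y.1,
        φ.symmL_continuousLinearMapAt (hNφ y), φ.continuousLinearMapAt_symmL (hNφ y)⟩
    exact (ε y).symm.injective.comp (hb.1.comp u.2.1.1)
  refine ⟨N, ⟨hxφ, u₀, hEx.symm⟩, fun y ↦ ⟨_, he y⟩,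
    fun y u ↦ Units.mk0 _ (det_complexMatrix_ne_zero (κ y u) (hκI y u) (hκinj y u)), ?_, ?_, ?_⟩
  · have h := T.continuousOn_symm.comp_continuous
      (f := fun y : N ↦ ((y.1, (ε y : (Fin C.rank → ℂ) →L[ℝ] F)) : B × _))
      (continuous_subtype_val.prodMk hεcont) (fun y ↦ ⟨⟨Set.mem_univ _, hNφ y⟩, Set.mem_univ _⟩)
    refine h.congr fun y ↦ ?_
    refine congrArg (TotalSpace.mk y.1) ?_
    refine (Bundle.Pretrivialization.continuousLinearMap_symm_apply' (RingHom.id ℝ)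
      (Bundle.Trivial.trivialization B (Fin C.rank → ℂ)) φ ⟨Set.mem_univ _, hNφ y⟩ _).trans ?_
    rw [Bundle.Trivial.continuousLinearMapAt_trivialization]
    rfl
  · refine Units.isEmbedding_val₀.continuous_iff.2 ?_
    refine Continuous.matrix_det (continuous_complexMatrix.comp ?_)
    refine (hεsymm.comp (f := fun p : C.FrameBundle N ↦ (⟨p.1.1, p.2.1⟩ : N))
      ((FiberBundle.continuous_proj _ _).comp continuous_subtype_val |>.subtype_mk _)).clm_comp ?_
    have h := T.continuousOn.comp_continuous (f := fun p : C.FrameBundle N ↦ p.1)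
      continuous_subtype_val (fun p ↦ ⟨Set.mem_univ _, hNφ ⟨p.1.1, p.2.1⟩⟩)
    refine (continuous_snd.comp h).congr fun p ↦ ?_
    ext z
    change φ.continuousLinearMapAt ℝ p.1.1 (p.1.2
      ((Bundle.Trivial.trivialization B (Fin C.rank → ℂ)).symmL ℝ p.1.1 z)) =
        φ.continuousLinearMapAt ℝ p.1.1 (p.1.2 z)
    rw [Bundle.Trivial.symmL_trivialization]
    rfl
  · intro y u v A h
    ext
    have := complexMatrix_comp (κ y u) (κ y v) (hκI y u) A.1 (fun z ↦ by
      rw [hκapp, hκapp]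
      exact congrArg (fun w ↦ (ε y).symm (φ.continuousLinearMapAt ℝ y.1 w)) (h z))
    simp only [Units.val_mk0, Units.val_mul, this, Matrix.det_mul]
    rfl


theorem ComplexStructure.continuous_of_locally (C : ComplexStructure F V) {Z : Type*}
    [TopologicalSpace Z] {U : Set B} (f : C.FrameBundle U → Z)
    (h : ∀ x ∈ U, ∃ (V : Opens B) (_ : x ∈ V) (i : (V : Set B) ⊆ U),
      Continuous fun p : C.FrameBundle V ↦ f ⟨p.1, i p.2.1, p.2.2⟩) : Continuous f := by
  refine continuous_iff_continuousAt.2 fun p ↦ ?_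
  obtain ⟨V, hV, i, hf⟩ := h p.1.1 p.2.1
  let ι : C.FrameBundle V → C.FrameBundle U := fun q ↦ ⟨q.1, i q.2.1, q.2.2⟩
  have hι : Topology.IsOpenEmbedding ι := by
    refine ⟨Topology.IsEmbedding.inclusion (s := {p : C.HomBundle | p.1 ∈ V ∧ C.IsFrame p.1 p.2})
      (t := {p : C.HomBundle | p.1 ∈ U ∧ C.IsFrame p.1 p.2}) (fun q hq ↦ ⟨i hq.1, hq.2⟩), ?_⟩
    have : Set.range ι = (fun q : C.FrameBundle U ↦ q.1.1) ⁻¹' V := by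
      ext q
      exact ⟨by rintro ⟨q, rfl⟩; exact q.2.1, fun hq ↦ ⟨⟨q.1, hq, q.2.2⟩, rfl⟩⟩
    rw [this]
    exact V.isOpen.preimage ((FiberBundle.continuous_proj _ _).comp continuous_subtype_val)
  exact (hι.continuousAt_iff (x := ⟨p.1, hV, p.2.2⟩)).1 hf.continuousAt

/-- The nonzero elements of all the tensor powers `Lₓ^{⊗k}`, `k : ℤ`, of the fibre at `x` of the
line bundle `L = det (V, J)`, as a group under the tensor product. A nonzero `ℓ ∈ Lₓ^{⊗k}` is
given by its coordinate `s u ∈ ℂˣ` in each frame `u`, so that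
`ℓ = s u • (u e₁ ∧ ⋯ ∧ u eₘ)^{⊗k}`; the coordinates in two frames `u` and `u ∘ A` are related by
`s (u ∘ A) * (det A) ^ k = s u` (written additively below). -/
def ComplexStructure.detPowers (C : ComplexStructure F V) (x : B) :
    AddSubgroup (ℤ × (C.Frame x → Additive ℂˣ)) where
  carrier := {p | ∀ (u v : C.Frame x) (A : GL (Fin C.rank) ℂ),
    (∀ z : Fin C.rank → ℂ, v.1 z = u.1 (A.1.mulVec z)) →
      p.2 v + p.1 • Additive.ofMul (Matrix.GeneralLinearGroup.det A) = p.2 u}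
  zero_mem' u v A _ := by simp
  add_mem' {p q} hp hq u v A h := by
    have h1 := hp u v A h
    have h2 := hq u v A h
    simp only [Prod.snd_add, Prod.fst_add, Pi.add_apply, ← h1, ← h2, add_zsmul]
    abel
  neg_mem' {p} hp u v A h := by
    have h1 := hp u v A h
    simp only [Prod.snd_neg, Prod.fst_neg, Pi.neg_apply, ← h1, neg_zsmul]
    abel

/-- Continuity of a nowhere vanishing section of the powers of `det (V, J)`: its degree is locally
constant, and its coordinates depend continuously on the frame. -/
def ComplexStructure.detPowersPredicate (C : ComplexStructure F V) :
    LocalAddPredicate (X := TopCat.of B) (fun x : B ↦ C.detPowers x) where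
  pred {U} f := Continuous (fun x : U ↦ (f x).1.1) ∧
    Continuous (fun p : C.FrameBundle (U : Set B) ↦ (f ⟨p.1.1, p.2.1⟩).1.2 ⟨p.1.2, p.2.2⟩)
  res {U V} i f hf := by
    refine ⟨hf.1.comp (Opens.isOpenEmbedding_of_le i.le).continuous, ?_⟩
    exact hf.2.comp (f := fun p : C.FrameBundle (U : Set B) ↦
      (⟨p.1, i.le p.2.1, p.2.2⟩ : C.FrameBundle (V : Set B)))
      (continuous_subtype_val.subtype_mk _)
  locality {U} f h := by
    refine ⟨(TopCat.continuousLocal (TopCat.of B) ℤ).locality _ fun x ↦ ?_,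
      C.continuous_of_locally _ fun x hx ↦ ?_⟩
    · obtain ⟨V, hV, i, h1, -⟩ := h x
      exact ⟨V, hV, i, h1⟩
    · obtain ⟨V, hV, i, -, h2⟩ := h ⟨x, hx⟩
      exact ⟨V, hV, i.le, h2⟩
  zero_mem := ⟨continuous_const, continuous_const⟩
  add_mem h h' := ⟨h.1.add h'.1, h.2.add h'.2⟩
  neg_mem h := ⟨h.1.neg, h.2.neg⟩

/-- The sheaf of pairs `(k, s)` with `k` a locally constant integer and `s` a continuous nowhere
vanishing section of `L^{⊗k}`, where `L = det (V, J)`. -/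
abbrev ComplexStructure.detPowersSheaf (C : ComplexStructure F V) : AbSheaf (TopCat.of B) :=
  C.detPowersPredicate.sheaf

/-- A nonzero complex number, as a nonzero element of `L^{⊗0}`. -/
def ComplexStructure.ofUnits (C : ComplexStructure F V) (x : B) :
    Additive ℂˣ →+ C.detPowers x where
  toFun c := ⟨(0, fun _ ↦ c), fun u v A _ ↦ by simp⟩
  map_zero' := rfl
  map_add' c d := Subtype.ext (Prod.ext (add_zero (0 : ℤ)).symm rfl)

/-- The degree of a nonzero element of `L^{⊗k}`. -/
def ComplexStructure.degree (C : ComplexStructure F V) (x : B) : C.detPowers x →+ ℤ :=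
  (AddMonoidHom.fst ℤ (C.Frame x → Additive ℂˣ)).comp (C.detPowers x).subtype

/-- The exact sequence `0 → C⁰(ℂˣ) → {(k, s)} → ℤ → 0` attached to `L = det (V, J)`. The preimage of
the constant section `1` is the sheaf of nowhere vanishing sections of `L`. -/
def ComplexStructure.detSequence (C : ComplexStructure F V) :
    ShortComplex (AbSheaf (TopCat.of B)) where
  X₁ := continuousSheaf (TopCat.of B) (Additive ℂˣ)
  X₂ := C.detPowersSheaf
  X₃ := continuousSheaf (TopCat.of B) ℤ
  f := LocalAddPredicate.hom _ _ C.ofUnits (fun {U} f hf ↦ ⟨continuous_const, hf.comp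
    (f := fun p : C.FrameBundle (U : Set B) ↦ (⟨p.1.1, p.2.1⟩ : U))
    (((FiberBundle.continuous_proj _ _).comp continuous_subtype_val).subtype_mk _)⟩)
  g := LocalAddPredicate.hom _ _ C.degree (fun _ hf ↦ hf.1)
  zero := by
    ext U f
    exact Subtype.ext (funext fun x ↦ rfl)


theorem ComplexStructure.exists_matrix (C : ComplexStructure F V) (x : B) (u v : C.Frame x) :
    ∃ A : GL (Fin C.rank) ℂ, ∀ z : Fin C.rank → ℂ, v.1 z = u.1 (A.1.mulVec z) := by
  let ul : (Fin C.rank → ℂ) ≃ₗ[ℝ] V x := LinearEquiv.ofBijective u.1.toLinearMap u.2.1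
  have hul : ∀ z, ul z = u.1 z := fun _ ↦ rfl
  let T : (Fin C.rank → ℂ) →L[ℝ] (Fin C.rank → ℂ) :=
    LinearMap.toContinuousLinearMap (ul.symm.toLinearMap ∘ₗ v.1.toLinearMap)
  have hT : ∀ z, u.1 (T z) = v.1 z := fun z ↦ ul.apply_symm_apply (v.1 z)
  have hTI : ∀ z, T (Complex.I • z) = Complex.I • T z := by
    intro z
    apply u.2.1.1
    refine (hT _).trans ((v.2.2 z).trans ?_)
    rw [← hT]
    exact (u.2.2 (T z)).symm
  have hinj : Function.Injective T := fun a b hab ↦ v.2.1.1 (by rw [← hT a, ← hT b, hab])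
  refine ⟨Matrix.GeneralLinearGroup.mkOfDetNeZero _ (det_complexMatrix_ne_zero T hTI hinj),
    fun z ↦ ?_⟩
  rw [← hT]
  exact congrArg u.1 (complexMatrix_mulVec T hTI z).symm

theorem ComplexStructure.detSequence_shortExact [FiniteDimensional ℝ F] (C : ComplexStructure F V) :
    C.detSequence.ShortExact := by
  apply shortExact_of_sections
  · intro U f g h
    refine Subtype.ext (funext fun x ↦ ?_)
    obtain ⟨N, hN, e, -⟩ := C.exists_localFrame x.1
    have := congrArg (fun t ↦ t.1.2) (congrFun (congrArg Subtype.val h) x)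
    exact congrFun this (e ⟨x.1, hN⟩)
  · intro U s hs x hx
    obtain ⟨N, hN, e, -, he, -⟩ := C.exists_localFrame x
    have h0 : ∀ y : U.unop, (s.1 y).1.1 = 0 := fun y ↦ congrFun (congrArg Subtype.val hs) y
    let W : Opens B := U.unop ⊓ N
    refine ⟨W, homOfLE inf_le_left, ⟨hx, hN⟩,
      ⟨fun y ↦ (s.1 ⟨y.1, y.2.1⟩).1.2 (e ⟨y.1, y.2.2⟩), ?_⟩, ?_⟩
    · refine s.2.2.comp (f := fun y : W ↦ (⟨⟨y.1, (e ⟨y.1, y.2.2⟩).1⟩, y.2.1,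
        (e ⟨y.1, y.2.2⟩).2⟩ : C.FrameBundle (U.unop : Set B))) ?_
      exact (he.comp (f := fun y : W ↦ (⟨y.1, y.2.2⟩ : N)) (by fun_prop)).subtype_mk _
    · refine Subtype.ext (funext fun y ↦ Subtype.ext (Prod.ext (h0 ⟨y.1, y.2.1⟩).symm
        (funext fun u ↦ ?_)))
      obtain ⟨A, hA⟩ := C.exists_matrix y.1 u (e ⟨y.1, y.2.2⟩)
      have := (s.1 ⟨y.1, y.2.1⟩).2 u (e ⟨y.1, y.2.2⟩) A hA
      rw [h0, zero_smul, add_zero] at this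
      exact this
  · intro U s x hx
    obtain ⟨N, hN, -, δ, -, hδ, hA⟩ := C.exists_localFrame x
    have hs : Continuous s.1 := s.2
    let O : Set U := s.1 ⁻¹' {s.1 ⟨x, hx⟩}
    have hO : IsOpen O := (isOpen_discrete _).preimage hs
    let W : Opens B := ⟨Subtype.val '' O ∩ N,
      (U.isOpen.isOpenMap_subtype_val _ hO).inter N.isOpen⟩
    have hWU : W ≤ U := by rintro _ ⟨⟨y, _, rfl⟩, _⟩; exact y.2
    have hWs : ∀ y : W, s.1 ⟨y.1, hWU y.2⟩ = s.1 ⟨x, hx⟩ := by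
      rintro ⟨_, ⟨y, hy, rfl⟩, _⟩
      exact hy
    let k : ℤ := s.1 ⟨x, hx⟩
    have hWN : W ≤ N := fun _ hy ↦ hy.2
    let σ : ∀ y : W, C.Frame y.1 → Additive ℂˣ := fun y u ↦ Additive.ofMul (δ ⟨y.1, hWN y.2⟩ u ^ (-k))
    have hσ : ∀ y : W, (k, σ y) ∈ C.detPowers y.1 := by
      intro y u v A h
      have h1 : δ ⟨y.1, hWN y.2⟩ v = _ := hA ⟨y.1, hWN y.2⟩ u v A h
      refine congrArg Additive.ofMul (?_ : δ ⟨y.1, hWN y.2⟩ v ^ (-k) *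
        Matrix.GeneralLinearGroup.det A ^ k = δ ⟨y.1, hWN y.2⟩ u ^ (-k))
      rw [h1, mul_zpow, mul_assoc, ← zpow_add, neg_add_cancel, zpow_zero, mul_one]
    have hδW : Continuous fun p : C.FrameBundle (W : Set B) ↦
        δ ⟨p.1.1, hWN p.2.1⟩ ⟨p.1.2, p.2.2⟩ :=
      hδ.comp (f := fun p : C.FrameBundle (W : Set B) ↦
        (⟨p.1, hWN p.2.1, p.2.2⟩ : C.FrameBundle (N : Set B)))
        (continuous_subtype_val.subtype_mk _)
    have hσc : Continuous fun p : C.FrameBundle (W : Set B) ↦ σ ⟨p.1.1, p.2.1⟩ ⟨p.1.2, p.2.2⟩ :=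
      hδW.zpow (-k)
    let t : C.detPowersPredicate.sections W :=
      ⟨fun y ↦ ⟨(k, σ y), hσ y⟩, continuous_const, hσc⟩
    exact ⟨W, homOfLE hWU, ⟨⟨⟨x, hx⟩, rfl, rfl⟩, hN⟩, t,
      Subtype.ext (funext fun y ↦ (hWs y).symm)⟩

/-- The first Chern class `c₁(V, J) ∈ H²(B, ℤ)`: the isomorphism class of `L = det (V, J)` in
`H¹(B, C⁰(ℂˣ))` is the image of `1 ∈ H⁰(B, ℤ)` under the connecting homomorphism of the sequence
attached to `L`, and `c₁(V, J) = c₁(L)` is its image under the connecting homomorphism of the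
exponential sequence. -/
def ComplexStructure.firstChernClass [FiniteDimensional ℝ F] (C : ComplexStructure F V) :
    IntegralCohomology (TopCat.of B) 2 :=
  connectingHom (exponentialSequence_shortExact (TopCat.of B)) 1
    (connectingHom C.detSequence_shortExact 0 (integralUnit (TopCat.of B)))

end Frames

/-! ### Hypercomplex manifolds -/

section Manifold

variable (E : Type) [NormedAddCommGroup E] [NormedSpace ℝ E]
  (M : Type u) [TopologicalSpace M] [ChartedSpace E M] [IsManifold 𝓘(ℝ, E) ∞ M]

/-- A smooth almost complex structure. -/
structure AlmostComplexStructure where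
  J : ∀ x : M, TangentSpace 𝓘(ℝ, E) x →L[ℝ] TangentSpace 𝓘(ℝ, E) x
  contMDiff_J : ContMDiff 𝓘(ℝ, E) (𝓘(ℝ, E).prod 𝓘(ℝ, E →L[ℝ] E)) ∞
    fun x ↦ TotalSpace.mk' (E →L[ℝ] E)
      (E := fun x : M ↦ TangentSpace 𝓘(ℝ, E) x →L[ℝ] TangentSpace 𝓘(ℝ, E) x) x (J x)
  J_J : ∀ x v, J x (J x v) = -v

variable {E M}

/-- Integrability of an almost complex structure: the Nijenhuis tensor
`[JX, JY] - J[JX, Y] - J[X, JY] - [X, Y]` vanishes. -/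
def AlmostComplexStructure.IsIntegrable (A : AlmostComplexStructure E M) : Prop :=
  ∀ X Y : ∀ x : M, TangentSpace 𝓘(ℝ, E) x,
    ContMDiff 𝓘(ℝ, E) 𝓘(ℝ, E).tangent ∞ (fun x ↦ (⟨x, X x⟩ : TangentBundle 𝓘(ℝ, E) M)) →
    ContMDiff 𝓘(ℝ, E) 𝓘(ℝ, E).tangent ∞ (fun x ↦ (⟨x, Y x⟩ : TangentBundle 𝓘(ℝ, E) M)) →
    ∀ x,
      VectorField.mlieBracket 𝓘(ℝ, E) (fun y ↦ A.J y (X y)) (fun y ↦ A.J y (Y y)) x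
        - A.J x (VectorField.mlieBracket 𝓘(ℝ, E) (fun y ↦ A.J y (X y)) Y x)
        - A.J x (VectorField.mlieBracket 𝓘(ℝ, E) X (fun y ↦ A.J y (Y y)) x)
        - VectorField.mlieBracket 𝓘(ℝ, E) X Y x = 0

/-- The tangent bundle with its almost complex structure, as a complex vector bundle. -/
def AlmostComplexStructure.tangentComplexStructure (A : AlmostComplexStructure E M) :
    ComplexStructure E (fun x : M ↦ TangentSpace 𝓘(ℝ, E) x) where
  J := A.J
  continuous_J := A.contMDiff_J.continuous
  J_J := A.J_J

/-- The first Chern class `c₁(M, J) ∈ H²(M, ℤ)`: that of the tangent bundle `(TM, J)`. -/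
def AlmostComplexStructure.firstChernClass [FiniteDimensional ℝ E]
    (A : AlmostComplexStructure E M) : IntegralCohomology (TopCat.of M) 2 :=
  A.tangentComplexStructure.firstChernClass

variable (E M)

/-- A hypercomplex structure: an action of the quaternions on the tangent bundle such that the
operators `I`, `J`, `K` are integrable complex structures. -/
structure HypercomplexStructure where
  I : AlmostComplexStructure E M
  J : AlmostComplexStructure E M
  K : AlmostComplexStructure E M
  I_J : ∀ x v, I.J x (J.J x v) = K.J x v
  J_I : ∀ x v, J.J x (I.J x v) = -K.J x v
  integrable_I : I.IsIntegrable
  integrable_J : J.IsIntegrable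
  integrable_K : K.IsIntegrable

end Manifold

end

end Hypercomplex

/-!
The determinant line bundle `L` of `(TM, I)` has local trivializations whose transition functions
are positive real, and this kills its Chern class.

Since `J` anticommutes with `I`, every tangent space is a quaternionic vector space, and any two of
these are isomorphic (`exists_intertwining_equiv`). Hence there are frames of `(TM, I)` which carry
one fixed quaternionic structure `σ` of `ℂᵐ` to `J`, and averaging over the quaternions makes them
continuous locally (`ComplexStructure.exists_local_quaternionic_frame`). Two such frames differ by a
matrix commuting with `σ`, and its determinant is a positive real number
(`exists_pos_det_eq_of_commute`): the eigenvalues come in pairs `μ`, `conj μ`.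

So it makes sense for a section of a power `L^{⊗k}` to be positive. The positive sections form an
exact sequence `0 → C⁰(ℝ) → {(k, s)} → ℤ → 0`
(`ComplexStructure.positiveDetSequence_shortExact`), where `t : ℝ` acts by `exp t`. It maps to the
sequence `0 → C⁰(ℂˣ) → {(k, s)} → ℤ → 0` defining the class of `L` by the identity on `ℤ` and by the
real exponential on the left. Therefore the class of `L` in `H¹(M, C⁰(ℂˣ))` is the image of a class
of `H¹(M, C⁰(ℝ))` under the real exponential, which lifts to `C⁰(ℂ)` through `z ↦ exp (2 π i z)`.
By exactness the connecting homomorphism of the exponential sequence sends it to zero.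

This is a statement about complex vector bundles with a quaternionic structure
(`ComplexStructure.firstChernClass_eq_zero_of_anticommute`), applied here to `(TM, I)` and `J`.
-/

namespace Hypercomplex

noncomputable section

/-! ### Linear algebra of quaternionic structures -/

section QuaternionicLinear

/-- The determinant of a complex-linear endomorphism commuting with a quaternionic structure `σ` is
a nonnegative real number. If `v` is an eigenvector with eigenvalue `μ`, then `σ v` is one with
eigenvalue `conj μ`, so that the plane spanned by `v` and `σ v` contributes the factor `|μ|²`, and
one passes to the quotient by this plane. -/
theorem exists_nonneg_det_eq_of_commute {V : Type*} [AddCommGroup V] [Module ℂ V]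
    [FiniteDimensional ℂ V] (σ : V →ₛₗ[starRingEnd ℂ] V) (hσ : ∀ v, σ (σ v) = -v) (T : V →ₗ[ℂ] V)
    (hT : ∀ v, T (σ v) = σ (T v)) : ∃ r : ℝ, 0 ≤ r ∧ LinearMap.det T = r := by
  induction hd : Module.finrank ℂ V using Nat.strong_induction_on generalizing V with
  | _ d ih =>
    rcases subsingleton_or_nontrivial V with hV | hV
    · refine ⟨1, zero_le_one, ?_⟩
      rw [Complex.ofReal_one, LinearMap.det_eq_one_of_subsingleton]
    obtain ⟨μ, hμ⟩ := Module.End.exists_eigenvalue T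
    obtain ⟨v, hv⟩ := hμ.exists_hasEigenvector
    have hv0 : v ≠ 0 := hv.2
    have hTv : T v = μ • v := hv.apply_eq_smul
    have hTσ : T (σ v) = (starRingEnd ℂ μ) • σ v := by rw [hT, hTv, map_smulₛₗ]
    have hli : LinearIndependent ℂ ![v, σ v] := by
      refine (LinearIndependent.pair_iff' hv0).2 fun c hc ↦ ?_
      have h := hσ v
      rw [← hc, map_smulₛₗ, ← hc, smul_smul, ← Complex.normSq_eq_conj_mul_self,
        ← sub_eq_zero, sub_neg_eq_add] at h
      have h' : ((Complex.normSq c : ℂ) + 1) • v = 0 := by rw [add_smul, one_smul, h]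
      rcases smul_eq_zero.1 h' with h1 | h1
      · have := Complex.normSq_nonneg c
        have h2 : Complex.normSq c + 1 = 0 := by exact_mod_cast h1
        linarith
      · exact hv0 h1
    let W : Submodule ℂ V := Submodule.span ℂ (Set.range ![v, σ v])
    let b : Module.Basis (Fin 2) ℂ W := Module.Basis.span hli
    have hb0 : (b 0 : V) = v :=
      congrArg Subtype.val (Module.Basis.span_apply hli 0)
    have hb1 : (b 1 : V) = σ v :=
      congrArg Subtype.val (Module.Basis.span_apply hli 1)
    have hvW : v ∈ W := Submodule.subset_span ⟨0, rfl⟩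
    have hσW : σ v ∈ W := Submodule.subset_span ⟨1, rfl⟩
    have hWT : W ≤ W.comap T := by
      refine Submodule.span_le.2 ?_
      rintro _ ⟨i, rfl⟩
      fin_cases i
      · change T v ∈ W
        exact hTv ▸ W.smul_mem _ hvW
      · change T (σ v) ∈ W
        exact hTσ ▸ W.smul_mem _ hσW
    have hWσ : W ≤ W.comap σ := by
      refine Submodule.span_le.2 ?_
      rintro _ ⟨i, rfl⟩
      fin_cases i
      · exact hσW
      · change σ (σ v) ∈ W
        exact hσ v ▸ W.neg_mem hvW
    have hWd : Module.finrank ℂ W = 2 := by simpa using Module.finrank_eq_card_basis b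
    have hlt : Module.finrank ℂ (V ⧸ W) < d := by
      have := W.finrank_quotient_add_finrank
      omega
    obtain ⟨r, hr, hdet⟩ := ih _ hlt (W.mapQ W σ hWσ)
      (fun x ↦ by
        obtain ⟨x, rfl⟩ := W.mkQ_surjective x
        exact congrArg W.mkQ (hσ x))
      (W.mapQ W T hWT)
      (fun x ↦ by
        obtain ⟨x, rfl⟩ := W.mkQ_surjective x
        exact congrArg W.mkQ (hT x)) rfl
    have hdetW : LinearMap.det (T.restrict hWT) = Complex.normSq μ := by
      have h0 : T.restrict hWT (b 0) = μ • b 0 := Subtype.ext (by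
        rw [LinearMap.coe_restrict_apply, Submodule.coe_smul, hb0, hTv])
      have h1 : T.restrict hWT (b 1) = starRingEnd ℂ μ • b 1 := Subtype.ext (by
        rw [LinearMap.coe_restrict_apply, Submodule.coe_smul, hb1, hTσ])
      rw [← LinearMap.det_toMatrix b, Matrix.det_fin_two]
      simp [LinearMap.toMatrix_apply, h0, h1, Complex.mul_conj]
    refine ⟨Complex.normSq μ * r, mul_nonneg (Complex.normSq_nonneg _) hr, ?_⟩
    rw [LinearMap.det_eq_det_mul_det W T hWT, hdet, hdetW, Complex.ofReal_mul]

/-- Two anticommuting complex structures `I` and `J` define an action of the quaternions. -/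
def quaternionAction {V : Type*} [AddCommGroup V] [Module ℝ V] (I J : V →ₗ[ℝ] V)
    (hI : ∀ v, I (I v) = -v) (hJ : ∀ v, J (J v) = -v) (hIJ : ∀ v, J (I v) = -I (J v)) :
    Quaternion ℝ →ₐ[ℝ] Module.End ℝ V :=
  QuaternionAlgebra.lift
    { i := I
      j := J
      k := I * J
      i_mul_i := LinearMap.ext fun v ↦ by simp [hI]
      j_mul_j := LinearMap.ext fun v ↦ by simp [hJ]
      i_mul_j := rfl
      j_mul_i := LinearMap.ext fun v ↦ by simp [hIJ] }

theorem quaternionAction_i {V : Type*} [AddCommGroup V] [Module ℝ V] (I J : V →ₗ[ℝ] V)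
    (hI : ∀ v, I (I v) = -v) (hJ : ∀ v, J (J v) = -v) (hIJ : ∀ v, J (I v) = -I (J v)) (v : V) :
    quaternionAction I J hI hJ hIJ (⟨0, 1, 0, 0⟩ : Quaternion ℝ) v = I v := by
  change QuaternionAlgebra.Basis.lift (A := Module.End ℝ V) _
    (⟨0, 1, 0, 0⟩ : Quaternion ℝ) v = I v
  simp [QuaternionAlgebra.Basis.lift]

theorem quaternionAction_j {V : Type*} [AddCommGroup V] [Module ℝ V] (I J : V →ₗ[ℝ] V)
    (hI : ∀ v, I (I v) = -v) (hJ : ∀ v, J (J v) = -v) (hIJ : ∀ v, J (I v) = -I (J v)) (v : V) :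
    quaternionAction I J hI hJ hIJ (⟨0, 0, 1, 0⟩ : Quaternion ℝ) v = J v := by
  change QuaternionAlgebra.Basis.lift (A := Module.End ℝ V) _
    (⟨0, 0, 1, 0⟩ : Quaternion ℝ) v = J v
  simp [QuaternionAlgebra.Basis.lift]

/-- Modules over the quaternions of the same finite real dimension are isomorphic. -/
theorem exists_intertwining_equiv {V W : Type*} [AddCommGroup V] [Module ℝ V]
    [AddCommGroup W] [Module ℝ W] [FiniteDimensional ℝ V] [FiniteDimensional ℝ W]
    (h : Module.finrank ℝ V = Module.finrank ℝ W) (I J : V →ₗ[ℝ] V)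
    (hI : ∀ v, I (I v) = -v) (hJ : ∀ v, J (J v) = -v) (hIJ : ∀ v, J (I v) = -I (J v))
    (I' J' : W →ₗ[ℝ] W)
    (hI' : ∀ v, I' (I' v) = -v) (hJ' : ∀ v, J' (J' v) = -v) (hIJ' : ∀ v, J' (I' v) = -I' (J' v)) :
    ∃ f : V ≃ₗ[ℝ] W, (∀ v, f (I v) = I' (f v)) ∧ ∀ v, f (J v) = J' (f v) := by
  let ρ := quaternionAction I J hI hJ hIJ
  let ρ' := quaternionAction I' J' hI' hJ' hIJ'
  let _ : Module (Quaternion ℝ) V := Module.compHom V ρ.toRingHom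
  let _ : Module (Quaternion ℝ) W := Module.compHom W ρ'.toRingHom
  have : IsScalarTower ℝ (Quaternion ℝ) V := ⟨fun r c v ↦ by
    change ρ (r • c) v = r • ρ c v
    rw [map_smul]; rfl⟩
  have : IsScalarTower ℝ (Quaternion ℝ) W := ⟨fun r c v ↦ by
    change ρ' (r • c) v = r • ρ' c v
    rw [map_smul]; rfl⟩
  have : Module.Finite (Quaternion ℝ) V := Module.Finite.of_restrictScalars_finite ℝ _ _
  have : Module.Finite (Quaternion ℝ) W := Module.Finite.of_restrictScalars_finite ℝ _ _
  have hfin : Module.finrank (Quaternion ℝ) V = Module.finrank (Quaternion ℝ) W := by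
    have h1 := Module.finrank_mul_finrank ℝ (Quaternion ℝ) V
    have h2 := Module.finrank_mul_finrank ℝ (Quaternion ℝ) W
    rw [Quaternion.finrank_eq_four] at h1 h2
    omega
  let g : V ≃ₗ[Quaternion ℝ] W := LinearEquiv.ofFinrankEq V W hfin
  refine ⟨g.restrictScalars ℝ, fun v ↦ ?_, fun v ↦ ?_⟩
  · rw [← quaternionAction_i I J hI hJ hIJ, ← quaternionAction_i I' J' hI' hJ' hIJ']
    exact g.map_smul _ v
  · rw [← quaternionAction_j I J hI hJ hIJ, ← quaternionAction_j I' J' hI' hJ' hIJ']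
    exact g.map_smul _ v

/-- The determinant of an invertible complex matrix commuting with a quaternionic structure `σ` on
`ℂᵐ` is a positive real number. -/
theorem exists_pos_det_eq_of_commute {m : ℕ} (σ : (Fin m → ℂ) →L[ℝ] (Fin m → ℂ))
    (hσ : ∀ z, σ (σ z) = -z) (hσI : ∀ z, σ (Complex.I • z) = -(Complex.I • σ z))
    (A : GL (Fin m) ℂ) (hA : ∀ z, A.1.mulVec (σ z) = σ (A.1.mulVec z)) :
    ∃ r : ℝ, 0 < r ∧ A.1.det = r := by
  let σ' : (Fin m → ℂ) →ₛₗ[starRingEnd ℂ] (Fin m → ℂ) :=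
    { toFun := σ
      map_add' := map_add σ
      map_smul' := fun c z ↦ by
        have hc : ∀ (c : ℂ) (w : Fin m → ℂ), c • w = c.re • w + c.im • (Complex.I • w) := by
          intro c w
          ext i
          simp only [Pi.smul_apply, Pi.add_apply, smul_eq_mul, Complex.real_smul]
          conv_lhs => rw [← Complex.re_add_im c]
          ring
        rw [hc c z, map_add, map_smul, map_smul, hσI, hc (starRingEnd ℂ c), Complex.conj_re,
          Complex.conj_im, smul_neg, neg_smul] }
  obtain ⟨r, hr, h⟩ := exists_nonneg_det_eq_of_commute σ' hσ (Matrix.toLin' A.1) (fun z ↦ by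
    rw [Matrix.toLin'_apply, Matrix.toLin'_apply]
    exact hA z)
  rw [LinearMap.det_toLin'] at h
  refine ⟨r, lt_of_le_of_ne hr fun h0 ↦ ?_, h⟩
  rw [← h0, Complex.ofReal_zero] at h
  exact ((Matrix.isUnit_iff_isUnit_det _).1 A.isUnit).ne_zero h

end QuaternionicLinear

/-! ### Quaternionic frames -/

section QuaternionicFrames

variable {B : Type u} [TopologicalSpace B] {F : Type} [NormedAddCommGroup F] [NormedSpace ℝ F]
  {V : B → Type} [∀ x, AddCommGroup (V x)] [∀ x, Module ℝ (V x)] [∀ x, TopologicalSpace (V x)]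
  [∀ x, IsTopologicalAddGroup (V x)] [∀ x, ContinuousSMul ℝ (V x)]
  [TopologicalSpace (TotalSpace F V)] [FiberBundle F V] [VectorBundle ℝ F V]

namespace ComplexStructure

/-- A complex frame `ℂᵐ ≃ (V x, C)` is quaternionic if it carries the antilinear structure `σ` of
`ℂᵐ` to the second complex structure `D` of `V x`. -/
def IsQuaternionic (C D : ComplexStructure F V) (σ : (Fin C.rank → ℂ) →L[ℝ] (Fin C.rank → ℂ))
    (x : B) (u : C.Frame x) : Prop :=
  ∀ z : Fin C.rank → ℂ, u.1 (σ z) = D.J x (u.1 z)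

/-- A complex frame, as a linear equivalence. -/
def Frame.equiv {C : ComplexStructure F V} {x : B} (u : C.Frame x) :
    (Fin C.rank → ℂ) ≃ₗ[ℝ] V x :=
  LinearEquiv.ofBijective u.1.toLinearMap u.2.1

theorem Frame.equiv_smul_I {C : ComplexStructure F V} {x : B} (u : C.Frame x) (z : Fin C.rank → ℂ) :
    Frame.equiv u (Complex.I • z) = C.J x (Frame.equiv u z) :=
  u.2.2 z

/-- The structure `D`, read in a frame of a single fibre, is a quaternionic structure on `ℂᵐ`; it
serves as a model for all the fibres. -/
theorem exists_quaternionic_model [FiniteDimensional ℝ F] (C D : ComplexStructure F V)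
    (hCD : ∀ x v, D.J x (C.J x v) = -C.J x (D.J x v)) (x : B) :
    ∃ σ : (Fin C.rank → ℂ) →L[ℝ] (Fin C.rank → ℂ), (∀ z, σ (σ z) = -z) ∧
      ∀ z, σ (Complex.I • z) = -(Complex.I • σ z) := by
  obtain ⟨N, hN, e, -⟩ := C.exists_localFrame x
  let ε := Frame.equiv (e ⟨x, hN⟩)
  let σ : (Fin C.rank → ℂ) →ₗ[ℝ] (Fin C.rank → ℂ) :=
    ε.symm.toLinearMap ∘ₗ (D.J x).toLinearMap ∘ₗ ε.toLinearMap
  have hσ : ∀ z, ε (σ z) = D.J x (ε z) := fun z ↦ ε.apply_symm_apply _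
  refine ⟨LinearMap.toContinuousLinearMap σ, fun z ↦ ?_, fun z ↦ ?_⟩
  · change σ (σ z) = -z
    apply ε.injective
    rw [hσ, hσ, D.J_J, map_neg]
  · change σ (Complex.I • z) = -(Complex.I • σ z)
    apply ε.injective
    rw [hσ, Frame.equiv_smul_I, hCD, map_neg, Frame.equiv_smul_I, hσ]

/-- Quaternionic frames exist for every model `σ`, since the quaternionic vector spaces `ℂᵐ` and
`V x` have the same dimension. -/
theorem exists_quaternionic_frame [FiniteDimensional ℝ F] (C D : ComplexStructure F V)
    (hCD : ∀ x v, D.J x (C.J x v) = -C.J x (D.J x v))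
    (σ : (Fin C.rank → ℂ) →L[ℝ] (Fin C.rank → ℂ)) (hσ : ∀ z, σ (σ z) = -z)
    (hσI : ∀ z, σ (Complex.I • z) = -(Complex.I • σ z)) (x : B) :
    ∃ u : C.Frame x, C.IsQuaternionic D σ x u := by
  obtain ⟨N, hN, e, -⟩ := C.exists_localFrame x
  let ε := Frame.equiv (e ⟨x, hN⟩)
  have : FiniteDimensional ℝ (V x) := ε.finiteDimensional
  let i : (Fin C.rank → ℂ) →ₗ[ℝ] (Fin C.rank → ℂ) :=
    (Complex.I • LinearMap.id (R := ℂ) (M := Fin C.rank → ℂ)).restrictScalars ℝ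
  have hi : ∀ z, i (i z) = -z := fun z ↦ by
    change Complex.I • Complex.I • z = -z
    rw [smul_smul, Complex.I_mul_I, neg_one_smul]
  obtain ⟨f, hf, hf'⟩ := exists_intertwining_equiv ε.finrank_eq i σ.toLinearMap hi hσ hσI
    (C.J x).toLinearMap (D.J x).toLinearMap (C.J_J x) (D.J_J x) (hCD x)
  exact ⟨⟨LinearMap.toContinuousLinearMap (E := Fin C.rank → ℂ) f.toLinearMap, f.bijective, hf⟩,
    hf'⟩

/-- Near every point there is a continuous quaternionic frame: a frame which is constant in a
trivialization and quaternionic at `x` is averaged over the action of the quaternions, and the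
result is still invertible near `x`. -/
theorem exists_local_quaternionic_frame [FiniteDimensional ℝ F] (C D : ComplexStructure F V)
    (hCD : ∀ x v, D.J x (C.J x v) = -C.J x (D.J x v))
    (σ : (Fin C.rank → ℂ) →L[ℝ] (Fin C.rank → ℂ)) (hσ : ∀ z, σ (σ z) = -z)
    (hσI : ∀ z, σ (Complex.I • z) = -(Complex.I • σ z)) (x : B) :
    ∃ (N : Opens B) (_ : x ∈ N) (q : ∀ y : N, C.Frame y.1),
      Continuous (fun y : N ↦ (⟨y.1, (q y).1⟩ : C.HomBundle)) ∧
      ∀ y : N, C.IsQuaternionic D σ y.1 (q y) := by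
  let φ := trivializationAt F V x
  let T := trivializationAt ((Fin C.rank → ℂ) →L[ℝ] F)
    (fun x ↦ Bundle.Trivial B (Fin C.rank → ℂ) x →L[ℝ] V x) x
  have hxφ : x ∈ φ.baseSet := mem_baseSet_trivializationAt F V x
  let Aφ : (C : ComplexStructure F V) → B → F →L[ℝ] F := fun C y ↦
    (φ.continuousLinearMapAt ℝ y).comp ((C.J y).comp (φ.symmL ℝ y))
  have hAcont : ∀ C, ContinuousOn (Aφ C) φ.baseSet := by
    intro C
    have h := (trivializationAt (F →L[ℝ] F) (fun x ↦ V x →L[ℝ] V x) x).continuousOn.comp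
      C.continuous_J.continuousOn (s := φ.baseSet) (fun y hy ↦ ⟨hy, hy⟩)
    exact continuous_snd.comp_continuousOn h
  have hAφ : ∀ C, ∀ y ∈ φ.baseSet, ∀ v, Aφ C y (φ.continuousLinearMapAt ℝ y v) =
      φ.continuousLinearMapAt ℝ y (C.J y v) := by
    intro C y hy v
    simp only [Aφ, ContinuousLinearMap.comp_apply]
    rw [φ.symmL_continuousLinearMapAt hy]
  have hAs : ∀ C, ∀ y ∈ φ.baseSet, ∀ v, φ.symmL ℝ y (Aφ C y v) = C.J y (φ.symmL ℝ y v) := by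
    intro C y hy v
    simp only [Aφ, ContinuousLinearMap.comp_apply]
    rw [φ.symmL_continuousLinearMapAt hy]
  have hAA : ∀ C, ∀ y ∈ φ.baseSet, ∀ v, Aφ C y (Aφ C y v) = -v := by
    intro C y hy v
    have h1 : Aφ C y v = φ.continuousLinearMapAt ℝ y (C.J y (φ.symmL ℝ y v)) := rfl
    rw [h1, hAφ C y hy, C.J_J, map_neg, φ.continuousLinearMapAt_symmL hy]
  have hDC : ∀ y ∈ φ.baseSet, ∀ v, Aφ D y (Aφ C y v) = -Aφ C y (Aφ D y v) := by
    intro y hy v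
    have h1 : Aφ C y v = φ.continuousLinearMapAt ℝ y (C.J y (φ.symmL ℝ y v)) := rfl
    have h2 : Aφ D y v = φ.continuousLinearMapAt ℝ y (D.J y (φ.symmL ℝ y v)) := rfl
    rw [h1, h2, hAφ D y hy, hAφ C y hy, hCD, map_neg]
  obtain ⟨u, hu⟩ := exists_quaternionic_frame C D hCD σ hσ hσI x
  let u₀ : (Fin C.rank → ℂ) →L[ℝ] F := (φ.continuousLinearMapAt ℝ x).comp u.1
  have hu₀I : ∀ z, u₀ (Complex.I • z) = Aφ C x (u₀ z) := fun z ↦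
    (congrArg (φ.continuousLinearMapAt ℝ x) (u.2.2 z)).trans (hAφ C x hxφ _).symm
  have hu₀σ : ∀ z, u₀ (σ z) = Aφ D x (u₀ z) := fun z ↦
    (congrArg (φ.continuousLinearMapAt ℝ x) (hu z)).trans (hAφ D x hxφ _).symm
  let i₀ : (Fin C.rank → ℂ) →L[ℝ] (Fin C.rank → ℂ) :=
    (Complex.I • ContinuousLinearMap.id ℂ (Fin C.rank → ℂ)).restrictScalars ℝ
  -- the projection onto the maps intertwining `i` with `C`
  let E₁ : B → (Fin C.rank → ℂ) →L[ℝ] F := fun y ↦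
    (2⁻¹ : ℝ) • (u₀ - (Aφ C y).comp (u₀.comp i₀))
  have hE₁app : ∀ y z, E₁ y z = (2⁻¹ : ℝ) • (u₀ z - Aφ C y (u₀ (Complex.I • z))) :=
    fun y z ↦ rfl
  -- the projection onto the maps which moreover intertwine `σ` with `D`
  let E : B → (Fin C.rank → ℂ) →L[ℝ] F := fun y ↦
    (2⁻¹ : ℝ) • (E₁ y - (Aφ D y).comp ((E₁ y).comp σ))
  have hEapp : ∀ y z, E y z = (2⁻¹ : ℝ) • (E₁ y z - Aφ D y (E₁ y (σ z))) := fun y z ↦ rfl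
  have hE₁I : ∀ y ∈ φ.baseSet, ∀ z, E₁ y (Complex.I • z) = Aφ C y (E₁ y z) := by
    intro y hy z
    rw [hE₁app, hE₁app, (Aφ C y).map_smul, map_sub, hAA C y hy, smul_smul, Complex.I_mul_I,
      neg_one_smul, map_neg, map_neg]
    congr 1
    abel
  have hEI : ∀ y ∈ φ.baseSet, ∀ z, E y (Complex.I • z) = Aφ C y (E y z) := by
    intro y hy z
    rw [hEapp, hEapp, (Aφ C y).map_smul, map_sub, hE₁I y hy, hσI, map_neg, hE₁I y hy, map_neg,
      hDC y hy, neg_neg]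
  have hEσ : ∀ y ∈ φ.baseSet, ∀ z, E y (σ z) = Aφ D y (E y z) := by
    intro y hy z
    rw [hEapp, hEapp, (Aφ D y).map_smul, map_sub, hAA D y hy, hσ, map_neg, map_neg]
    congr 1
    abel
  have hE₁x : E₁ x = u₀ := by
    ext1 z
    rw [hE₁app, hu₀I, hAA C x hxφ, sub_neg_eq_add, ← two_smul ℝ, smul_smul]
    norm_num
  have hEx : E x = u₀ := by
    ext1 z
    rw [hEapp, hE₁x, hu₀σ, hAA D x hxφ, sub_neg_eq_add, ← two_smul ℝ, smul_smul]
    norm_num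
  have hE₁cont : ContinuousOn E₁ φ.baseSet := by
    have h : ContinuousOn (fun y ↦ u₀ - (Aφ C y).comp (u₀.comp i₀)) φ.baseSet :=
      continuousOn_const.sub ((hAcont C).clm_comp continuousOn_const)
    exact h.const_smul (2⁻¹ : ℝ)
  have hEcont : ContinuousOn E φ.baseSet := by
    have h : ContinuousOn (fun y ↦ E₁ y - (Aφ D y).comp ((E₁ y).comp σ)) φ.baseSet :=
      hE₁cont.sub ((hAcont D).clm_comp (hE₁cont.clm_comp continuousOn_const))
    exact h.const_smul (2⁻¹ : ℝ)
  let S : Set ((Fin C.rank → ℂ) →L[ℝ] F) :=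
    Set.range ((↑) : ((Fin C.rank → ℂ) ≃L[ℝ] F) → ((Fin C.rank → ℂ) →L[ℝ] F))
  have hS : IsOpen S := ContinuousLinearEquiv.isOpen
  let N : Opens B := ⟨φ.baseSet ∩ E ⁻¹' S, hEcont.isOpen_inter_preimage φ.open_baseSet hS⟩
  have hNφ : ∀ y : N, y.1 ∈ φ.baseSet := fun y ↦ y.2.1
  have hxS : E x ∈ S := by
    have hb : Function.Bijective (φ.continuousLinearMapAt ℝ x) :=
      Function.bijective_iff_has_inverse.2 ⟨φ.symmL ℝ x,
        φ.symmL_continuousLinearMapAt hxφ, φ.continuousLinearMapAt_symmL hxφ⟩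
    refine ⟨(LinearEquiv.ofBijective u₀.toLinearMap (hb.comp u.2.1)).toContinuousLinearEquiv, ?_⟩
    rw [hEx]
    rfl
  have hq : ∀ y : N, C.IsFrame y.1 ((φ.symmL ℝ y.1).comp (E y.1)) := by
    intro y
    refine ⟨?_, fun z ↦ ?_⟩
    · have hb : Function.Bijective (φ.symmL ℝ y.1) :=
        Function.bijective_iff_has_inverse.2 ⟨φ.continuousLinearMapAt ℝ y.1,
          φ.continuousLinearMapAt_symmL (hNφ y), φ.symmL_continuousLinearMapAt (hNφ y)⟩
      obtain ⟨ε, hε⟩ := y.2.2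
      exact hb.comp (hε ▸ ε.bijective)
    · change φ.symmL ℝ y.1 (E y.1 (Complex.I • z)) = C.J y.1 (φ.symmL ℝ y.1 (E y.1 z))
      rw [hEI y.1 (hNφ y), hAs C y.1 (hNφ y)]
  refine ⟨N, ⟨hxφ, hxS⟩, fun y ↦ ⟨_, hq y⟩, ?_, fun y z ↦ ?_⟩
  · have h := T.continuousOn_symm.comp_continuous
      (f := fun y : N ↦ ((y.1, E y.1) : B × ((Fin C.rank → ℂ) →L[ℝ] F)))
      (continuous_subtype_val.prodMk (hEcont.comp_continuous continuous_subtype_val hNφ))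
      (fun y ↦ ⟨⟨Set.mem_univ _, hNφ y⟩, Set.mem_univ _⟩)
    refine h.congr fun y ↦ ?_
    refine congrArg (TotalSpace.mk y.1) ?_
    refine (Bundle.Pretrivialization.continuousLinearMap_symm_apply' (RingHom.id ℝ)
      (Bundle.Trivial.trivialization B (Fin C.rank → ℂ)) φ ⟨Set.mem_univ _, hNφ y⟩ _).trans ?_
    rw [Bundle.Trivial.continuousLinearMapAt_trivialization]
    rfl
  · change φ.symmL ℝ y.1 (E y.1 (σ z)) = D.J y.1 (φ.symmL ℝ y.1 (E y.1 z))
    rw [hEσ y.1 (hNφ y), hAs D y.1 (hNφ y)]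

/-- The matrix relating two quaternionic frames has positive determinant. -/
theorem IsQuaternionic.exists_pos_det_eq {C D : ComplexStructure F V}
    {σ : (Fin C.rank → ℂ) →L[ℝ] (Fin C.rank → ℂ)} (hσ : ∀ z, σ (σ z) = -z)
    (hσI : ∀ z, σ (Complex.I • z) = -(Complex.I • σ z)) {x : B} {u v : C.Frame x}
    (hu : C.IsQuaternionic D σ x u) (hv : C.IsQuaternionic D σ x v) (A : GL (Fin C.rank) ℂ)
    (hA : ∀ z : Fin C.rank → ℂ, v.1 z = u.1 (A.1.mulVec z)) : ∃ r : ℝ, 0 < r ∧ A.1.det = r := by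
  refine exists_pos_det_eq_of_commute σ hσ hσI A fun z ↦ u.2.1.1 ?_
  exact (hA (σ z)).symm.trans ((hv z).trans ((congrArg (D.J x) (hA z)).trans (hu _).symm))

end ComplexStructure

end QuaternionicFrames

/-! ### Extension classes and connecting homomorphisms -/

section ExtClass

open Abelian

variable {A : Type*} [Category A] [Abelian A] [HasExt A]

theorem mk₀_comp_comp_extClass {S : ShortComplex A} (hS : S.ShortExact) {X : A} (f : X ⟶ S.X₂) :
    (Ext.mk₀ (f ≫ S.g)).comp hS.extClass (zero_add 1) = 0 := by
  rw [← Ext.mk₀_comp_mk₀, Ext.comp_assoc_of_second_deg_zero, hS.comp_extClass, Ext.comp_zero]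

/-- Let `φ : S₁ ⟶ S₂` be a morphism of short exact sequences which is an isomorphism on the right.
Then the extension class of `S₂` comes from that of `S₁`, so it is killed by every class `γ` whose
pullback along the left component of `φ` is zero. -/
theorem extClass_comp_eq_zero_of_hom {S₁ S₂ : ShortComplex A} (h₁ : S₁.ShortExact)
    (h₂ : S₂.ShortExact) (φ : S₁ ⟶ S₂) (hφ : IsIso φ.τ₃) {Y : A} {n m : ℕ} (γ : Ext S₂.X₁ Y n)
    (hγ : (Ext.mk₀ φ.τ₁).comp γ (zero_add n) = 0) (h : 1 + n = m) :
    h₂.extClass.comp γ h = 0 := by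
  have key : h₂.extClass = (Ext.mk₀ (inv φ.τ₃)).comp
      (h₁.extClass.comp (Ext.mk₀ φ.τ₁) (add_zero 1)) (zero_add 1) := by
    rw [ShortComplex.ShortExact.extClass_naturality h₁ h₂ φ, Ext.mk₀_comp_mk₀_assoc,
      IsIso.inv_hom_id, Ext.mk₀_id_comp]
  rw [key, Ext.comp_assoc _ _ γ _ h (by lia), Ext.comp_assoc_of_second_deg_zero, hγ,
    Ext.comp_zero, Ext.comp_zero]

/-- A class killing the extension class of `S` kills the image of the connecting homomorphism. -/
theorem postcomp_connectingHom_eq_zero {X : TopCat.{u}} {S : ShortComplex (AbSheaf X)}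
    (hS : S.ShortExact) {Y : AbSheaf X} {n m : ℕ} (γ : Ext S.X₁ Y n) (h : 1 + n = m)
    (hγ : hS.extClass.comp γ h = 0) {k l : ℕ} (hl : k + 1 + n = l) (x : Sheaf.H S.X₃ k) :
    γ.postcomp _ hl (connectingHom hS k x) = 0 := by
  have h' := Ext.comp_assoc x hS.extClass γ rfl h hl
  rw [hγ, Ext.comp_zero] at h'
  exact h'

theorem subsingleton_H_of_isEmpty {B : Type u} [TopologicalSpace B] [IsEmpty B]
    {G : TopCat.of B → Type} [∀ x, AddCommGroup (G x)] (P : LocalAddPredicate G) (k : ℕ) :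
    Subsingleton (Sheaf.H P.sheaf k) := by
  refine Sheaf.subsingleton_H_of_isZero ((Limits.IsZero.iff_id_eq_zero _).2 ?_) k
  ext U f
  exact Subtype.ext (funext fun x ↦ (IsEmpty.false (α := B) x.1).elim)

end ExtClass

/-! ### Positive sections of the determinant line bundle -/

section PositiveSections

/-- The homomorphism `t ↦ t / (2 π i)` from `ℝ` to `ℂ`; its composition with `expHom` is the real
exponential. -/
def realToComplex : ℝ →+ ℂ where
  toFun t := t / (2 * Real.pi * Complex.I)
  map_zero' := by simp
  map_add' s t := by rw [Complex.ofReal_add, add_div]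

theorem continuous_realToComplex : Continuous realToComplex :=
  Complex.continuous_ofReal.div_const _

/-- The real exponential, as a homomorphism from `ℝ` to `ℂˣ`. -/
def realExpHom : ℝ →+ Additive ℂˣ := expHom.comp realToComplex

theorem realExpHom_val (t : ℝ) :
    ((Additive.toMul (realExpHom t) : ℂˣ) : ℂ) = (Real.exp t : ℝ) := by
  change Complex.exp (2 * Real.pi * Complex.I * (t / (2 * Real.pi * Complex.I))) = _
  rw [mul_div_cancel₀ _ Complex.two_pi_I_ne_zero, Complex.ofReal_exp]

theorem continuous_realExpHom : Continuous realExpHom :=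
  continuous_expHom.comp continuous_realToComplex

theorem realExpHom_log_norm {c : Additive ℂˣ} (hc : c ∈ realExpHom.range) :
    realExpHom (Real.log ‖((Additive.toMul c : ℂˣ) : ℂ)‖) = c := by
  obtain ⟨t, rfl⟩ := hc
  rw [realExpHom_val, Complex.norm_real, Real.norm_of_nonneg (Real.exp_pos t).le, Real.log_exp]

theorem realExpHom_injective : Function.Injective realExpHom := by
  intro s t h
  have h' := congrArg (fun c ↦ ((Additive.toMul c : ℂˣ) : ℂ)) h
  simp only [realExpHom_val] at h'
  exact Real.exp_injective (Complex.ofReal_injective h')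

theorem ofMul_mem_range_realExpHom {c : ℂˣ} {r : ℝ} (hr : 0 < r) (hc : (c : ℂ) = r) :
    Additive.ofMul c ∈ realExpHom.range := by
  refine ⟨Real.log r, Additive.toMul.injective (Units.ext ?_)⟩
  rw [realExpHom_val, Real.exp_log hr, ← hc]
  rfl

variable {B : Type u} [TopologicalSpace B] {F : Type} [NormedAddCommGroup F] [NormedSpace ℝ F]
  {V : B → Type} [∀ x, AddCommGroup (V x)] [∀ x, Module ℝ (V x)] [∀ x, TopologicalSpace (V x)]
  [∀ x, IsTopologicalAddGroup (V x)] [∀ x, ContinuousSMul ℝ (V x)]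
  [TopologicalSpace (TotalSpace F V)] [FiberBundle F V] [VectorBundle ℝ F V]

namespace ComplexStructure

variable (C D : ComplexStructure F V) (σ : (Fin C.rank → ℂ) →L[ℝ] (Fin C.rank → ℂ))

/-- The elements of the powers of `det (V, C)` whose coordinates in all quaternionic frames are
positive real numbers. -/
def positiveDetPowers (x : B) : AddSubgroup (C.detPowers x) where
  carrier := {p | ∀ u, C.IsQuaternionic D σ x u → p.1.2 u ∈ realExpHom.range}
  zero_mem' _ _ := zero_mem _
  add_mem' hp hq u hu := add_mem (hp u hu) (hq u hu)
  neg_mem' hp u hu := neg_mem (hp u hu)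

/-- Continuity of a positive section of the powers of `det (V, C)`. -/
def positiveDetPowersPredicate :
    LocalAddPredicate (X := TopCat.of B) (fun x : B ↦ C.positiveDetPowers D σ x) where
  pred f := C.detPowersPredicate.pred (fun x ↦ (f x).1)
  res i _ hf := C.detPowersPredicate.res i _ hf
  locality _ h := C.detPowersPredicate.locality _ h
  zero_mem := C.detPowersPredicate.zero_mem
  add_mem h h' := C.detPowersPredicate.add_mem h h'
  neg_mem h := C.detPowersPredicate.neg_mem h

/-- The exponential of a real number, as a positive element of `L^{⊗0}`, where `L = det (V, C)`. -/
def ofReal (x : B) : ℝ →+ C.positiveDetPowers D σ x where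
  toFun t := ⟨C.ofUnits x (realExpHom t), fun _ _ ↦ ⟨t, rfl⟩⟩
  map_zero' := Subtype.ext (by simp)
  map_add' s t := Subtype.ext (by simp)

/-- The sequence `0 → C⁰(ℝ) → {(k, s)} → ℤ → 0`, where `s` is a positive continuous section
of `L^{⊗k}`, `L = det (V, C)`. It is exact if `D` makes `V` a bundle of quaternionic vector spaces
modelled on `σ`. -/
def positiveDetSequence : ShortComplex (AbSheaf (TopCat.of B)) where
  X₁ := continuousSheaf (TopCat.of B) ℝ
  X₂ := (C.positiveDetPowersPredicate D σ).sheaf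
  X₃ := continuousSheaf (TopCat.of B) ℤ
  f := LocalAddPredicate.hom _ _ (C.ofReal D σ) (fun {U} f hf ↦ ⟨continuous_const,
    (continuous_realExpHom.comp hf).comp
      (f := fun p : C.FrameBundle (U : Set B) ↦ (⟨p.1.1, p.2.1⟩ : U))
      (((FiberBundle.continuous_proj _ _).comp continuous_subtype_val).subtype_mk _)⟩)
  g := LocalAddPredicate.hom _ _ (fun x ↦ (C.degree x).comp (C.positiveDetPowers D σ x).subtype)
    (fun _ hf ↦ hf.1)
  zero := by
    ext U f
    exact Subtype.ext (funext fun x ↦ rfl)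

/-- The inclusion of the sequence of positive sections in the sequence of all sections, given on
the left by the real exponential. -/
def positiveDetSequenceHom : C.positiveDetSequence D σ ⟶ C.detSequence where
  τ₁ := LocalAddPredicate.hom _ _ (fun _ ↦ realExpHom) (fun _ hf ↦ continuous_realExpHom.comp hf)
  τ₂ := LocalAddPredicate.hom _ _ (fun x ↦ (C.positiveDetPowers D σ x).subtype) (fun _ hf ↦ hf)
  τ₃ := 𝟙 _
  comm₁₂ := rfl
  comm₂₃ := rfl

variable {C D σ}

/-- Exactness on the right is where positivity of quaternionic determinants enters: a local
determinant, normalized on one quaternionic frame, is positive on all of them. -/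
theorem positiveDetSequence_shortExact [FiniteDimensional ℝ F]
    (hCD : ∀ x v, D.J x (C.J x v) = -C.J x (D.J x v)) (hσ : ∀ z, σ (σ z) = -z)
    (hσI : ∀ z, σ (Complex.I • z) = -(Complex.I • σ z)) :
    (C.positiveDetSequence D σ).ShortExact := by
  apply shortExact_of_sections
  · intro U f g h
    refine Subtype.ext (funext fun x ↦ realExpHom_injective ?_)
    obtain ⟨u, -⟩ := C.exists_quaternionic_frame D hCD σ hσ hσI x.1
    have := congrArg (fun t ↦ t.1.1.2) (congrFun (congrArg Subtype.val h) x)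
    exact congrFun this u
  · intro U s hs x hx
    obtain ⟨N, hN, q, hqc, hq⟩ := C.exists_local_quaternionic_frame D hCD σ hσ hσI x
    have h0 : ∀ y : U.unop, (s.1 y).1.1.1 = 0 := fun y ↦ congrFun (congrArg Subtype.val hs) y
    let W : Opens B := U.unop ⊓ N
    let c : W → Additive ℂˣ := fun y ↦ (s.1 ⟨y.1, y.2.1⟩).1.1.2 (q ⟨y.1, y.2.2⟩)
    have hc : Continuous c := by
      refine s.2.2.comp (f := fun y : W ↦ (⟨⟨y.1, (q ⟨y.1, y.2.2⟩).1⟩, y.2.1,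
        (q ⟨y.1, y.2.2⟩).2⟩ : C.FrameBundle (U.unop : Set B))) ?_
      exact (hqc.comp (f := fun y : W ↦ (⟨y.1, y.2.2⟩ : N)) (by fun_prop)).subtype_mk _
    have hcr : ∀ y, c y ∈ realExpHom.range := fun y ↦ (s.1 ⟨y.1, y.2.1⟩).2 _ (hq ⟨y.1, y.2.2⟩)
    refine ⟨W, homOfLE inf_le_left, ⟨hx, hN⟩,
      ⟨fun y ↦ Real.log ‖((Additive.toMul (c y) : ℂˣ) : ℂ)‖, ?_⟩, ?_⟩
    · exact (continuous_norm.comp (continuous_iff_val.1 hc)).log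
        fun y ↦ norm_ne_zero_iff.2 (Units.ne_zero _)
    · refine Subtype.ext (funext fun y ↦ Subtype.ext (Subtype.ext
        (Prod.ext (h0 ⟨y.1, y.2.1⟩).symm (funext fun u ↦ ?_))))
      obtain ⟨A, hA⟩ := C.exists_matrix y.1 u (q ⟨y.1, y.2.2⟩)
      have := (s.1 ⟨y.1, y.2.1⟩).1.2 u (q ⟨y.1, y.2.2⟩) A hA
      rw [h0, zero_smul, add_zero] at this
      exact (realExpHom_log_norm (hcr y)).trans this
  · intro U s x hx
    obtain ⟨N₁, hN₁, -, δ, -, hδ, hA⟩ := C.exists_localFrame x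
    obtain ⟨N₂, hN₂, q, hqc, hq⟩ := C.exists_local_quaternionic_frame D hCD σ hσ hσI x
    have hs : Continuous s.1 := s.2
    let O : Set U := s.1 ⁻¹' {s.1 ⟨x, hx⟩}
    have hO : IsOpen O := (isOpen_discrete _).preimage hs
    let W : Opens B := ⟨Subtype.val '' O, U.isOpen.isOpenMap_subtype_val _ hO⟩ ⊓ (N₁ ⊓ N₂)
    have hWU : W ≤ U := by rintro _ ⟨⟨y, _, rfl⟩, _⟩; exact y.2
    have hWs : ∀ y : W, s.1 ⟨y.1, hWU y.2⟩ = s.1 ⟨x, hx⟩ := by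
      rintro ⟨_, ⟨y, hy, rfl⟩, _⟩
      exact hy
    let k : ℤ := s.1 ⟨x, hx⟩
    have hW₁ : W ≤ N₁ := fun _ hy ↦ hy.2.1
    have hW₂ : W ≤ N₂ := fun _ hy ↦ hy.2.2
    -- the local determinant, normalized to be `1` on the chosen quaternionic frame
    let η : ∀ y : W, C.Frame y.1 → ℂˣ := fun y u ↦
      δ ⟨y.1, hW₁ y.2⟩ u / δ ⟨y.1, hW₁ y.2⟩ (q ⟨y.1, hW₂ y.2⟩)
    have hηA : ∀ (y : W) (u v : C.Frame y.1) (A : GL (Fin C.rank) ℂ),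
        (∀ z : Fin C.rank → ℂ, v.1 z = u.1 (A.1.mulVec z)) →
          η y v = η y u * Matrix.GeneralLinearGroup.det A := by
      intro y u v A h
      have h1 : δ ⟨y.1, hW₁ y.2⟩ v = _ := hA ⟨y.1, hW₁ y.2⟩ u v A h
      simp only [η]
      rw [h1, mul_div_right_comm]
    let τ : ∀ y : W, C.Frame y.1 → Additive ℂˣ := fun y u ↦ Additive.ofMul (η y u ^ (-k))
    have hτ : ∀ y : W, (k, τ y) ∈ C.detPowers y.1 := by
      intro y u v A h
      refine congrArg Additive.ofMul (?_ : η y v ^ (-k) *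
        Matrix.GeneralLinearGroup.det A ^ k = η y u ^ (-k))
      rw [hηA y u v A h, mul_zpow, mul_assoc, ← zpow_add, neg_add_cancel, zpow_zero, mul_one]
    -- on a quaternionic frame `η` is the determinant of a change of quaternionic frames
    have hτpos : ∀ y : W, (⟨(k, τ y), hτ y⟩ : C.detPowers y.1) ∈ C.positiveDetPowers D σ y.1 := by
      intro y u hu
      obtain ⟨A, h⟩ := C.exists_matrix y.1 (q ⟨y.1, hW₂ y.2⟩) u
      obtain ⟨r, hr, hdet⟩ := (hq ⟨y.1, hW₂ y.2⟩).exists_pos_det_eq hσ hσI hu A h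
      have h1 : η y u = Matrix.GeneralLinearGroup.det A := by
        have h2 := hηA y _ u A h
        rwa [show η y (q ⟨y.1, hW₂ y.2⟩) = 1 from div_self' _, one_mul] at h2
      have h3 : Additive.ofMul (η y u) ∈ realExpHom.range :=
        ofMul_mem_range_realExpHom hr (h1 ▸ hdet)
      exact zsmul_mem h3 (-k)
    have hδW : Continuous fun p : C.FrameBundle (W : Set B) ↦
        δ ⟨p.1.1, hW₁ p.2.1⟩ ⟨p.1.2, p.2.2⟩ :=
      hδ.comp (f := fun p : C.FrameBundle (W : Set B) ↦
        (⟨p.1, hW₁ p.2.1, p.2.2⟩ : C.FrameBundle (N₁ : Set B)))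
        (continuous_subtype_val.subtype_mk _)
    have hqW : Continuous fun y : W ↦ δ ⟨y.1, hW₁ y.2⟩ (q ⟨y.1, hW₂ y.2⟩) :=
      hδ.comp (f := fun y : W ↦ (⟨⟨y.1, (q ⟨y.1, hW₂ y.2⟩).1⟩, hW₁ y.2,
        (q ⟨y.1, hW₂ y.2⟩).2⟩ : C.FrameBundle (N₁ : Set B)))
        ((hqc.comp (f := fun y : W ↦ (⟨y.1, hW₂ y.2⟩ : N₂)) (by fun_prop)).subtype_mk _)
    have hηc : Continuous fun p : C.FrameBundle (W : Set B) ↦ η ⟨p.1.1, p.2.1⟩ ⟨p.1.2, p.2.2⟩ :=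
      hδW.div' (hqW.comp (f := fun p : C.FrameBundle (W : Set B) ↦ (⟨p.1.1, p.2.1⟩ : W))
        (((FiberBundle.continuous_proj _ _).comp continuous_subtype_val).subtype_mk _))
    let t : (C.positiveDetPowersPredicate D σ).sections W :=
      ⟨fun y ↦ ⟨⟨(k, τ y), hτ y⟩, hτpos y⟩, continuous_const, hηc.zpow (-k)⟩
    exact ⟨W, homOfLE hWU, ⟨⟨⟨x, hx⟩, rfl, rfl⟩, hN₁, hN₂⟩, t,
      Subtype.ext (funext fun y ↦ (hWs y).symm)⟩

variable (C D σ) in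
/-- The extension class of the exponential sequence is killed by the real exponential, since the
latter lifts to `ℂ`. -/
theorem positiveDetSequenceHom_τ₁_comp_extClass :
    (Abelian.Ext.mk₀ (C.positiveDetSequenceHom D σ).τ₁).comp
      (exponentialSequence_shortExact (TopCat.of B)).extClass (zero_add 1) = 0 := by
  have h := mk₀_comp_comp_extClass (exponentialSequence_shortExact (TopCat.of B))
    (X := (C.positiveDetSequence D σ).X₁)
    ((continuousAddPredicate (TopCat.of B) ℝ).hom (continuousAddPredicate (TopCat.of B) ℂ)
      (fun _ ↦ realToComplex) (fun _ hf ↦ continuous_realToComplex.comp hf))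
  exact h

/-- The product of the two extension classes which define the first Chern class vanishes. -/
theorem detSequence_extClass_comp_extClass [FiniteDimensional ℝ F]
    (hS : (C.positiveDetSequence D σ).ShortExact) :
    C.detSequence_shortExact.extClass.comp
      (exponentialSequence_shortExact (TopCat.of B)).extClass (rfl : 1 + 1 = 2) = 0 := by
  have h := extClass_comp_eq_zero_of_hom hS C.detSequence_shortExact
    (C.positiveDetSequenceHom D σ) (inferInstanceAs (IsIso (𝟙 _)))
    (Y := (exponentialSequence (TopCat.of B)).X₁) (n := 1) (m := 2)
    (exponentialSequence_shortExact (TopCat.of B)).extClass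
    (C.positiveDetSequenceHom_τ₁_comp_extClass D σ) rfl
  exact h

theorem firstChernClass_eq_zero_of_shortExact [FiniteDimensional ℝ F]
    (hS : (C.positiveDetSequence D σ).ShortExact) : C.firstChernClass = 0 := by
  have h := postcomp_connectingHom_eq_zero (S := C.detSequence) C.detSequence_shortExact
    (Y := (exponentialSequence (TopCat.of B)).X₁) (n := 1) (m := 2)
    (exponentialSequence_shortExact (TopCat.of B)).extClass rfl
    (detSequence_extClass_comp_extClass hS) (k := 0) (l := 2) rfl (integralUnit (TopCat.of B))
  exact h

variable (C D) in
/-- The first Chern class of a complex vector bundle with a quaternionic structure vanishes. -/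
theorem firstChernClass_eq_zero_of_anticommute [FiniteDimensional ℝ F]
    (hCD : ∀ x v, D.J x (C.J x v) = -C.J x (D.J x v)) : C.firstChernClass = 0 := by
  rcases isEmpty_or_nonempty B with hB | ⟨⟨x⟩⟩
  -- over the empty space there is no fibre from which to take a model of the structure
  · exact (subsingleton_H_of_isEmpty (continuousAddPredicate (TopCat.of B) ℤ) 2).elim _ _
  · obtain ⟨σ, hσ, hσI⟩ := C.exists_quaternionic_model D hCD x
    exact firstChernClass_eq_zero_of_shortExact (positiveDetSequence_shortExact hCD hσ hσI)

end ComplexStructure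

end PositiveSections

end

end Hypercomplex

/-- The first Chern class of `(M, I)` vanishes for every hypercomplex manifold `(M, I, J, K)` of
quaternionic dimension `n`. -/
theorem mainTheorem5 (n : ℕ) (M : Type u) [TopologicalSpace M] [T2Space M]
    [SecondCountableTopology M] [ChartedSpace (EuclideanSpace ℝ (Fin (4 * n))) M]
    [IsManifold 𝓘(ℝ, EuclideanSpace ℝ (Fin (4 * n))) ∞ M]
    (Q : Hypercomplex.HypercomplexStructure (EuclideanSpace ℝ (Fin (4 * n))) M) :
    (Q.I.firstChernClass : Hypercomplex.IntegralCohomology (TopCat.of M) 2) = 0 := by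
  refine Hypercomplex.ComplexStructure.firstChernClass_eq_zero_of_anticommute
    Q.I.tangentComplexStructure Q.J.tangentComplexStructure fun x v ↦ ?_
  change Q.J.J x (Q.I.J x v) = -Q.I.J x (Q.J.J x v)
  rw [Q.J_I, Q.I_J]
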